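/- An instance consists of a finite set $P_v\subset\mathbb{Z}_{\ge 0}$ of voter positions with smallest element $0$ and largest element $R\ge 1$, a number $F(p)\in\mathbb{Z}_{\ge 0}$ of voters at each $p\in P_v$, and a number $m\ge 1$ of candidates. A strategy profile is a choice of $m$ distinct points $S=\{s_1,\dots,s_m\}$ of the real interval $[0,R]$. For $a\le b$ let $F(a,b)=\sum_{p\in P_v,\,a\le p\le b}F(p)$. If $s_l$ and $s_r$ are the immediate left and right neighbours of $s$ in $S$ (or $-\infty$, $+\infty$ if there is none), and $\mu_l=(s_l+s)/2$, $\mu_r=(s+s_r)/2$, then the utility of the candidate at $s\in S$ is $$u(s,S)=F(\mu_l,\mu_r)-\tfrac12F(\mu_l,\mu_l)-\tfrac12F(\mu_r,\mu_r),$$ where $F(\pm\infty,\pm\infty)=0$. The profile is an equilibrium if no candidate $i$ can strictly increase her utility by moving to a point $s_i'\in[0,R]$ with $s_i'\ne s_j$ for all $j\ne i$, the other candidates staying where they are. There is a single algorithm, running on a random access machine with unit-cost instructions (addition, truncated subtraction and comparison of natural numbers, indirect addressing), which, given $m$, $R$, $|P_v|$, the list of the voter positions and the list of the values of $F$, decides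 whether the instance has an equilibrium and, if so, outputs an equilibrium all of whose positions are multiples of $1/2^m$. Its running time is $O(m\,n^{12})$ with $n=2^{\lceil\log_2R\rceil+m}$, where the implied constant is absolute. In particular, its running time is polynomial in $|P_v|$ on every class of instances for which $2^m$ and $R$ are bounded by a fixed power of $|P_v|$. -/

import Mathlib

/-! ### The game: discrete voters, continuous candidate positions -/

namespace Hotelling

/-- An instance: a finite set of integer voter positions whose smallest element is `0` and whose
largest element is `R`, the number `F p` of voters at each voter position `p`, and the number `m`
of candidates. The candidates choose distinct points of the real interval `[0, R]`. -/
structure Instance where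
  /-- the voter positions -/
  voters : Finset ℕ
  /-- the number of candidates -/
  m : ℕ
  /-- the right end of the interval -/
  R : ℕ
  /-- the number of voters at a voter position (values off `voters` are never used) -/
  F : ℕ → ℕ
  one_le_m : 1 ≤ m
  one_le_R : 1 ≤ R
  zero_mem : 0 ∈ voters
  R_mem : R ∈ voters
  le_R : ∀ p ∈ voters, p ≤ R

/-- The point midway between `s` and its immediate left neighbour in `S`; it is `-∞` if there is no
such neighbour. -/
noncomputable def leftMean (S : Finset ℝ) (s : ℝ) : WithBot ℝ :=
  (S.filter (fun x => x < s)).max.map (fun l => (l + s) / 2)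

/-- The point midway between `s` and its immediate right neighbour in `S`; it is `+∞` if there is no
such neighbour. -/
noncomputable def rightMean (S : Finset ℝ) (s : ℝ) : WithTop ℝ :=
  (S.filter (fun x => s < x)).min.map (fun r => (s + r) / 2)

open Classical in
/-- The utility of the candidate at `s` when the occupied positions are `S`: the number of voters
between the two means, minus half of the voters at the left mean and half of those at the right
mean. -/
noncomputable def Instance.util (I : Instance) (S : Finset ℝ) (s : ℝ) : ℝ :=
  (∑ p ∈ I.voters.filter (fun p : ℕ =>
      leftMean S s ≤ ((p : ℝ) : WithBot ℝ) ∧ ((p : ℝ) : WithTop ℝ) ≤ rightMean S s), (I.F p : ℝ))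
    - (∑ p ∈ I.voters.filter (fun p : ℕ => ((p : ℝ) : WithBot ℝ) = leftMean S s), (I.F p : ℝ)) / 2
    - (∑ p ∈ I.voters.filter (fun p : ℕ => ((p : ℝ) : WithTop ℝ) = rightMean S s), (I.F p : ℝ)) / 2

/-- The set of positions occupied in a profile. -/
noncomputable def occupied {m : ℕ} (s : Fin m → ℝ) : Finset ℝ := Finset.univ.image s

/-- A strategy profile: distinct positions in `[0, R]`. -/
def Instance.IsProfile (I : Instance) (s : Fin I.m → ℝ) : Prop :=
  Function.Injective s ∧ ∀ i, s i ∈ Set.Icc (0 : ℝ) I.R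

/-- A pure Nash equilibrium: no candidate gains by moving to another point of `[0, R]` that is not
occupied by one of the other candidates. -/
def Instance.IsEquilibrium (I : Instance) (s : Fin I.m → ℝ) : Prop :=
  I.IsProfile s ∧
    ∀ i : Fin I.m, ∀ y ∈ Set.Icc (0 : ℝ) I.R, (∀ j, j ≠ i → y ≠ s j) →
      I.util (occupied (Function.update s i y)) y ≤ I.util (occupied s) (s i)

/-- `2 ^ (⌈log₂ R⌉ + m)`. -/
def Instance.size (I : Instance) : ℕ := 2 ^ (Nat.clog 2 I.R + I.m)

/-! ### The machine model: a random access machine with unit-cost instructions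

Registers and memory cells hold natural numbers. The only arithmetic operations are addition and
truncated subtraction; memory is addressed indirectly. -/

/-- The registers and the memory of the machine. -/
structure Store where
  reg : ℕ → ℕ
  mem : ℕ → ℕ

/-- Expressions; `load a` reads the memory cell whose address is the value of `a`. -/
inductive Expr where
  | const (c : ℕ)
  | reg (x : ℕ)
  | load (a : Expr)
  | add (a b : Expr)
  | sub (a b : Expr)

/-- The value of an expression. -/
def Expr.eval (σ : Store) : Expr → ℕ
  | .const c => c
  | .reg x => σ.reg x
  | .load a => σ.mem (a.eval σ)
  | .add a b => a.eval σ + b.eval σ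
  | .sub a b => a.eval σ - b.eval σ

/-- The number of steps needed to evaluate an expression: one for each node. -/
def Expr.cost : Expr → ℕ
  | .const _ => 1
  | .reg _ => 1
  | .load a => a.cost + 1
  | .add a b => a.cost + b.cost + 1
  | .sub a b => a.cost + b.cost + 1

/-- Programs. `assign x e` writes a register, `store a e` writes the memory cell at address `a`,
`ifLE a b P Q` runs `P` if `a ≤ b` and `Q` otherwise, `whileLE a b P` repeats `P` as long as
`a ≤ b`. -/
inductive Prog where
  | skip
  | assign (x : ℕ) (e : Expr)
  | store (a e : Expr)
  | seq (P Q : Prog)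
  | ifLE (a b : Expr) (P Q : Prog)
  | whileLE (a b : Expr) (P : Prog)

/-- `Runs P σ τ t`: started in `σ`, the program `P` halts in `τ` after exactly `t` steps. -/
inductive Runs : Prog → Store → Store → ℕ → Prop where
  | skip (σ : Store) : Runs .skip σ σ 1
  | assign (σ : Store) (x : ℕ) (e : Expr) :
      Runs (.assign x e) σ ⟨Function.update σ.reg x (e.eval σ), σ.mem⟩ (e.cost + 1)
  | store (σ : Store) (a e : Expr) :
      Runs (.store a e) σ ⟨σ.reg, Function.update σ.mem (a.eval σ) (e.eval σ)⟩
        (a.cost + e.cost + 1)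
  | seq {P Q : Prog} {σ τ υ : Store} {t u : ℕ} :
      Runs P σ τ t → Runs Q τ υ u → Runs (.seq P Q) σ υ (t + u)
  | ifLE_true {a b : Expr} {P Q : Prog} {σ τ : Store} {t : ℕ} :
      a.eval σ ≤ b.eval σ → Runs P σ τ t → Runs (.ifLE a b P Q) σ τ (a.cost + b.cost + 1 + t)
  | ifLE_false {a b : Expr} {P Q : Prog} {σ τ : Store} {t : ℕ} :
      ¬ a.eval σ ≤ b.eval σ → Runs Q σ τ t → Runs (.ifLE a b P Q) σ τ (a.cost + b.cost + 1 + t)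
  | whileLE_true {a b : Expr} {P : Prog} {σ τ υ : Store} {t u : ℕ} :
      a.eval σ ≤ b.eval σ → Runs P σ τ t → Runs (.whileLE a b P) τ υ u →
        Runs (.whileLE a b P) σ υ (a.cost + b.cost + 1 + t + u)
  | whileLE_false {a b : Expr} {P : Prog} {σ : Store} :
      ¬ a.eval σ ≤ b.eval σ → Runs (.whileLE a b P) σ σ (a.cost + b.cost + 1)

/-- The machine is deterministic: result and step count are determined by program and input. -/
theorem Runs.deterministic {P : Prog} {σ τ τ' : Store} {t t' : ℕ}
    (h : Runs P σ τ t) (h' : Runs P σ τ' t') : τ = τ' ∧ t = t' := by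
  induction h generalizing τ' t' with
  | skip | assign | store => cases h'; exact ⟨rfl, rfl⟩
  | seq _ _ ih₁ ih₂ =>
    cases h' with
    | seq k₁ k₂ =>
      obtain ⟨rfl, rfl⟩ := ih₁ k₁
      obtain ⟨rfl, rfl⟩ := ih₂ k₂
      exact ⟨rfl, rfl⟩
  | ifLE_true hc _ ih =>
    cases h' with
    | ifLE_true _ k => obtain ⟨rfl, rfl⟩ := ih k; exact ⟨rfl, rfl⟩
    | ifLE_false hn _ => exact absurd hc hn
  | ifLE_false hc _ ih =>
    cases h' with
    | ifLE_true hn _ => exact absurd hn hc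
    | ifLE_false _ k => obtain ⟨rfl, rfl⟩ := ih k; exact ⟨rfl, rfl⟩
  | whileLE_true hc _ _ ih₁ ih₂ =>
    cases h' with
    | whileLE_true _ k₁ k₂ =>
      obtain ⟨rfl, rfl⟩ := ih₁ k₁
      obtain ⟨rfl, rfl⟩ := ih₂ k₂
      exact ⟨rfl, rfl⟩
    | whileLE_false hn => exact absurd hc hn
  | whileLE_false hc =>
    cases h' with
    | whileLE_true hn _ _ => exact absurd hn hc
    | whileLE_false _ => exact ⟨rfl, rfl⟩

/-- The contents of the memory at the start: the voter positions in increasing order, followed by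
the numbers of voters at these positions in the same order. -/
def Instance.cells (I : Instance) : List ℕ :=
  I.voters.sort (· ≤ ·) ++ (I.voters.sort (· ≤ ·)).map I.F

/-- The initial store: `m`, `R` and the number of voter positions in the first three registers, the
voters in memory, and `0` everywhere else. -/
def Instance.input (I : Instance) : Store where
  reg := fun x => [I.m, I.R, I.voters.card].getD x 0
  mem := fun a => I.cells.getD a 0

/-- The profile read off from the first `m` memory cells: cell `i` holds the numerator of the
position of candidate `i`, the denominator being `2 ^ m`. -/
noncomputable def Instance.output (I : Instance) (τ : Store) : Fin I.m → ℝ :=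
  fun i => (τ.mem i : ℝ) / 2 ^ I.m

/-- The final store `τ` is a correct answer: it reports in register `0` whether there is an
equilibrium (`1`) or not (`0`), and if there is one, then it holds one, all of whose positions are
multiples of `1 / 2 ^ m`. -/
def Instance.CorrectAnswer (I : Instance) (τ : Store) : Prop :=
  ((∃ s, I.IsEquilibrium s) → τ.reg 0 = 1 ∧ I.IsEquilibrium (I.output τ)) ∧
    ((¬ ∃ s, I.IsEquilibrium s) → τ.reg 0 = 0)

end Hotelling

/-! ### Composing programs: contexts, computable expressions, commands -/

/-! The argument has a game-theoretic half and a machine half.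

Discretization. The utility at `y` depends only on how `y` compares with the rivals `x` and with
their reflections `2p - x` at the voters `p` (`util_image_congr`). Hence a map that is strictly
increasing on the relevant points, fixes `0` and `R`, and commutes with the reflections at the
voters carries equilibria to equilibria (`IsEquilibrium.comp`). The reflections at all integers
generate a group with fundamental domain `[0, 1]`, so any suitable map `ρ` of `[0, 1]` extends
equivariantly (`unfold`). The `m` positions fold to at most `m` inner points of `[0, 1]`; sending
these to their ranks divided by `2 ^ m` gives an equilibrium on the grid (`exists_grid`).

Local conditions. Against a grid profile, any deviation behaves like one at a grid point or at the
midpoint of a cell (`exists_coord_compare`), so finitely many deviations matter. An ordered profile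
is an equilibrium exactly when there is a threshold `T` such that every candidate earns at least
`T`, no deviation into a gap earns more than `T`, and nobody gains by moving between her own
neighbours (`IsPath.isEquilibrium`, `IsPath.exists_ok`). For the converse, `T` is the smallest
payoff. These conditions concern three consecutive candidates only, so dynamic programming over
pairs of consecutive slots decides whether a profile exists. The threshold is a difference of two
values of `cum`, so it is enumerated through the two arguments `x₁, x₂`, both smaller than `radix`.

The machine. `Computes`, `Decides` and `Executes` give rules for assembling programs together with
their time bounds; program and constant are chosen before the instance, which makes the algorithm
uniform. With `n` the size, multiplication by repeated addition costs one factor `n`, a value of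
`cum` costs `n ^ 2`, the test of a triple `n ^ 3`, and a table entry `n ^ 4`. There are `O(n ^ 4)`
entries in each of the `m + 1` layers, and `m + 1 ≤ 2 n`, so the total is `O(n ^ 9)`
(`exists_prog`), which is stronger than the required bound. -/

namespace Hotelling

/-- A context: the values `γ : Γ` the program currently knows, the registers below `b` that hold
them, the requirements on registers and memory, and the size in which running times are measured. -/
structure Ctx where
  Γ : Type
  b : ℕ
  size : Γ → ℕ
  size_pos : ∀ γ, 1 ≤ size γ
  regs : Γ → (ℕ → ℕ) → Prop
  mem : Γ → (ℕ → ℕ) → Prop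
  regs_congr : ∀ γ r r', (∀ x < b, r' x = r x) → regs γ r → regs γ r'

/-- Keep a further value `x` with `D γ x` in the register `r`. -/
abbrev Ctx.push (X : Ctx) (r : ℕ) (hr : X.b ≤ r) (D : X.Γ → ℕ → Prop) : Ctx where
  Γ := X.Γ × ℕ
  b := r + 1
  size := fun g => X.size g.1
  size_pos := fun g => X.size_pos g.1
  regs := fun g ρ => X.regs g.1 ρ ∧ ρ r = g.2 ∧ D g.1 g.2
  mem := fun g M => X.mem g.1 M
  regs_congr := fun g ρ ρ' h hρ =>
    ⟨X.regs_congr g.1 ρ ρ' (fun x hx => h x (by omega)) hρ.1, by rw [h r (by omega)]; exact hρ.2.1,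
      hρ.2.2⟩

/-- Restrict a context by a condition on the values. -/
abbrev Ctx.restrict (X : Ctx) (p : X.Γ → Prop) : Ctx where
  Γ := X.Γ
  b := X.b
  size := X.size
  size_pos := X.size_pos
  regs := fun γ ρ => X.regs γ ρ ∧ p γ
  mem := X.mem
  regs_congr := fun γ ρ ρ' h hρ => ⟨X.regs_congr γ ρ ρ' h hρ.1, hρ.2⟩

/-- Replace the requirements on the memory. -/
abbrev Ctx.setMem (X : Ctx) (J : X.Γ → (ℕ → ℕ) → Prop) : Ctx where
  Γ := X.Γ
  b := X.b
  size := X.size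
  size_pos := X.size_pos
  regs := X.regs
  mem := J
  regs_congr := X.regs_congr

/-- Some program computes `e` in the context `X` in time `O(size ^ a)`: above every level `k` there
is one that writes `e` to the register `k` and preserves the registers below `k` and the memory. -/
def Computes (X : Ctx) (e : X.Γ → ℕ) (a : ℕ) : Prop :=
  ∀ k, X.b ≤ k → ∃ (P : Prog) (c : ℕ), ∀ γ σ, X.regs γ σ.reg → X.mem γ σ.mem →
    ∃ τ t, Runs P σ τ t ∧ t ≤ c * X.size γ ^ a ∧ τ.mem = σ.mem ∧
      (∀ x < k, τ.reg x = σ.reg x) ∧ τ.reg k = e γ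

/-- Some program establishes `post` in the context `X` in time `O(size ^ a)`, preserving all
registers below any given level. -/
def Executes (X : Ctx) (post : X.Γ → (ℕ → ℕ) → Prop) (a : ℕ) : Prop :=
  ∀ k, X.b ≤ k → ∃ (P : Prog) (c : ℕ), ∀ γ σ, X.regs γ σ.reg → X.mem γ σ.mem →
    ∃ τ t, Runs P σ τ t ∧ t ≤ c * X.size γ ^ a ∧
      (∀ x < k, τ.reg x = σ.reg x) ∧ post γ τ.mem

/-! ### Rules for computing expressions -/

variable {X : Ctx} {a d : ℕ}

theorem Ctx.one_le_pow (X : Ctx) (γ : X.Γ) (a : ℕ) : 1 ≤ X.size γ ^ a :=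
  Nat.one_le_pow _ _ (X.size_pos γ)

theorem Computes.mono {e : X.Γ → ℕ} (h : Computes X e a) (hd : a ≤ d) : Computes X e d := by
  intro k hk
  obtain ⟨P, c, hP⟩ := h k hk
  refine ⟨P, c, fun γ σ h₁ h₂ => ?_⟩
  obtain ⟨τ, t, h3, h4, h5⟩ := hP γ σ h₁ h₂
  exact ⟨τ, t, h3, h4.trans (Nat.mul_le_mul_left _ (Nat.pow_le_pow_right (X.size_pos γ) hd)), h5⟩

theorem Computes.congr {e f : X.Γ → ℕ} (h : Computes X e a)
    (hef : ∀ γ ρ M, X.regs γ ρ → X.mem γ M → e γ = f γ) : Computes X f a := by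
  intro k hk
  obtain ⟨P, c, hP⟩ := h k hk
  refine ⟨P, c, fun γ σ h₁ h₂ => ?_⟩
  rw [← hef γ _ _ h₁ h₂]
  exact hP γ σ h₁ h₂

/-- Transport along a map of contexts. -/
theorem Computes.comap {Y : Ctx} {e : X.Γ → ℕ} (h : Computes X e a) (g : Y.Γ → X.Γ)
    (hb : X.b ≤ Y.b) (hs : ∀ γ, X.size (g γ) = Y.size γ)
    (hr : ∀ γ ρ, Y.regs γ ρ → X.regs (g γ) ρ)
    (hm : ∀ γ ρ M, Y.regs γ ρ → Y.mem γ M → X.mem (g γ) M) : Computes Y (fun γ => e (g γ)) a := by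
  intro k hk
  obtain ⟨P, c, hP⟩ := h k (hb.trans hk)
  refine ⟨P, c, fun γ σ h₁ h₂ => ?_⟩
  rw [← hs]
  exact hP (g γ) σ (hr _ _ h₁) (hm _ _ _ h₁ h₂)

/-- Weakening by a new variable. -/
theorem Computes.pop {e : X.Γ → ℕ} (h : Computes X e a) {r : ℕ} {hr : X.b ≤ r}
    {D : X.Γ → ℕ → Prop} : Computes (X.push r hr D) (fun g => e g.1) a :=
  h.comap (Y := X.push r hr D) (fun g => g.1) (Nat.le_succ_of_le hr) (fun _ => rfl)
    (fun _ _ h => h.1) (fun _ _ _ _ h => h)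

theorem Computes.restrict {e : X.Γ → ℕ} (h : Computes X e a) {p : X.Γ → Prop} :
    Computes (X.restrict p) e a :=
  h.comap (Y := X.restrict p) (fun g => g) le_rfl (fun _ => rfl) (fun _ _ h => h.1)
    (fun _ _ _ _ h => h)

theorem Computes.expr {e : X.Γ → ℕ} (E : Expr)
    (hE : ∀ γ σ, X.regs γ σ.reg → X.mem γ σ.mem → E.eval σ = e γ) : Computes X e a := by
  intro k hk
  refine ⟨.assign k E, E.cost + 1, fun γ σ h₁ h₂ =>
    ⟨_, _, .assign σ k E, Nat.le_mul_of_pos_right _ (X.one_le_pow γ a), rfl, fun x hx => ?_, ?_⟩⟩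
  · exact Function.update_of_ne hx.ne _ _
  · simp [hE γ σ h₁ h₂]

theorem Computes.const (c : ℕ) : Computes X (fun _ => c) a := .expr (.const c) fun _ _ _ _ => rfl

theorem Computes.top {r : ℕ} {hr : X.b ≤ r} {D : X.Γ → ℕ → Prop} :
    Computes (X.push r hr D) (fun g => g.2) a :=
  .expr (.reg r) fun _ _ h _ => h.2.1

theorem Computes.bind {e : X.Γ → ℕ} {f : X.Γ × ℕ → ℕ} (he : Computes X e a)
    (hf : ∀ (r : ℕ) (hr : X.b ≤ r), Computes (X.push r hr (fun γ x => x = e γ)) f a) :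
    Computes X (fun γ => f (γ, e γ)) a := by
  intro k hk
  obtain ⟨P, c, hP⟩ := he k hk
  obtain ⟨Q, c', hQ⟩ := hf k hk (k + 1) le_rfl
  -- The intermediate value occupies the register `k`, so `f` is computed one level higher and then
  -- copied down to `k`.
  refine ⟨.seq P (.seq Q (.assign k (.reg (k + 1)))), c + c' + 2, fun γ σ h₁ h₂ => ?_⟩
  obtain ⟨τ, t, h3, h4, h5, h6, h7⟩ := hP γ σ h₁ h₂
  obtain ⟨υ, u, k3, k4, k5, k6, k7⟩ := hQ (γ, e γ) τ
    ⟨X.regs_congr γ _ _ (fun x hx => h6 x (by omega)) h₁, h7, rfl⟩ (by rw [h5]; exact h₂)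
  refine ⟨_, _, .seq h3 (.seq k3 (.assign _ _ _)), ?_, k5.trans h5, fun x hx => ?_, ?_⟩
  · have := X.one_le_pow γ a
    simp only [Expr.cost] at k4 ⊢
    nlinarith
  · simp only
    rw [Function.update_of_ne hx.ne, k6 x (by omega), h6 x hx]
  · simp [Expr.eval, k7]

theorem Computes.add {e f : X.Γ → ℕ} (he : Computes X e a) (hf : Computes X f a) :
    Computes X (fun γ => e γ + f γ) a :=
  .bind (f := fun g => g.2 + f g.1) he fun r _ =>
    .bind (f := fun g : (X.Γ × ℕ) × ℕ => g.1.2 + g.2) hf.pop fun r' hr' =>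
      .expr (.add (.reg r) (.reg r')) fun g σ h _ => by simp [Expr.eval, h.1.2.1, h.2.1]

theorem Computes.sub {e f : X.Γ → ℕ} (he : Computes X e a) (hf : Computes X f a) :
    Computes X (fun γ => e γ - f γ) a :=
  .bind (f := fun g => g.2 - f g.1) he fun r _ =>
    .bind (f := fun g : (X.Γ × ℕ) × ℕ => g.1.2 - g.2) hf.pop fun r' hr' =>
      .expr (.sub (.reg r) (.reg r')) fun g σ h _ => by simp [Expr.eval, h.1.2.1, h.2.1]

/-- The memory is not a function of `γ`; what can be read from it is a value that the requirements
of the context force. -/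
theorem Computes.load {e v : X.Γ → ℕ} (he : Computes X e a)
    (hv : ∀ γ ρ M, X.regs γ ρ → X.mem γ M → M (e γ) = v γ) : Computes X v a :=
  .bind (f := fun g => v g.1) he fun r _ =>
    .expr (.load (.reg r)) fun g σ h k => by
      obtain ⟨h₁, h₂, h₃⟩ := h
      simp only [Expr.eval, h₂, h₃]
      exact hv g.1 _ _ h₁ k

/-- Each branch may assume its condition. This matters for table lookups, which are only justified
under such conditions. -/
theorem Computes.iteLE {e f g h : X.Γ → ℕ} (he : Computes X e a) (hf : Computes X f a)
    (hg : Computes (X.restrict fun γ => e γ ≤ f γ) g a)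
    (hh : Computes (X.restrict fun γ => ¬ e γ ≤ f γ) h a) :
    Computes X (fun γ => if e γ ≤ f γ then g γ else h γ) a := by
  intro k hk
  obtain ⟨P, c, hP⟩ := he k hk
  obtain ⟨Q, c', hQ⟩ := hf (k + 1) (by omega)
  obtain ⟨P₁, c₁, hP₁⟩ := hg k hk
  obtain ⟨P₂, c₂, hP₂⟩ := hh k hk
  refine ⟨.seq P (.seq Q (.ifLE (.reg k) (.reg (k + 1)) P₁ P₂)), c + c' + c₁ + c₂ + 3,
    fun γ σ h₁ h₂ => ?_⟩
  obtain ⟨τ, t, h3, h4, h5, h6, h7⟩ := hP γ σ h₁ h₂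
  obtain ⟨υ, u, k3, k4, k5, k6, k7⟩ := hQ γ τ
    (X.regs_congr γ _ _ (fun x hx => h6 x (by omega)) h₁) (by rw [h5]; exact h₂)
  have hr : X.regs γ υ.reg :=
    X.regs_congr γ _ _ (fun x hx => by rw [k6 x (by omega), h6 x (by omega)]) h₁
  have hm : X.mem γ υ.mem := by rw [k5, h5]; exact h₂
  have hk : υ.reg k = e γ := by rw [k6 k (by omega), h7]
  have hn := X.one_le_pow γ a
  beta_reduce
  split_ifs with hle
  · obtain ⟨ω, w, l3, l4, l5, l6, l7⟩ := hP₁ γ υ ⟨hr, hle⟩ hm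
    refine ⟨ω, _, .seq h3 (.seq k3 (.ifLE_true (by simpa [Expr.eval, hk, k7] using hle) l3)), ?_,
      by rw [l5, k5, h5], fun x hx => by rw [l6 x hx, k6 x (by omega), h6 x hx], l7⟩
    simp only [Expr.cost] at l4 ⊢
    nlinarith
  · obtain ⟨ω, w, l3, l4, l5, l6, l7⟩ := hP₂ γ υ ⟨hr, hle⟩ hm
    refine ⟨ω, _, .seq h3 (.seq k3 (.ifLE_false (by simpa [Expr.eval, hk, k7] using hle) l3)), ?_,
      by rw [l5, k5, h5], fun x hx => by rw [l6 x hx, k6 x (by omega), h6 x hx], l7⟩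
    simp only [Expr.cost] at l4 ⊢
    nlinarith

/-- A counting loop with invariant `inv`. -/
theorem Runs.for_loop {P : Prog} {i b N c : ℕ} {inv : ℕ → Store → Prop}
    (hreg : ∀ j σ, inv j σ → σ.reg i = j ∧ σ.reg b = N)
    (hstep : ∀ j < N, ∀ σ, inv j σ → ∃ τ t, Runs P σ τ t ∧ t ≤ c ∧ inv (j + 1) τ)
    {σ : Store} (h0 : inv 0 σ) :
    ∃ τ t, Runs (.whileLE (.add (.reg i) (.const 1)) (.reg b) P) σ τ t ∧ t ≤ N * (c + 5) + 5 ∧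
      inv N τ := by
  -- Induction on the number `q` of remaining rounds. The loop test `i + 1 ≤ b` costs 5 steps, and
  -- it is made once more at the exit.
  have key : ∀ q j, j + q = N → ∀ σ, inv j σ →
      ∃ τ t, Runs (.whileLE (.add (.reg i) (.const 1)) (.reg b) P) σ τ t ∧ t ≤ q * (c + 5) + 5 ∧
        inv N τ := by
    intro q
    induction q with
    | zero =>
      intro j hj σ hσ
      obtain ⟨h₁, h₂⟩ := hreg j σ hσ
      obtain rfl : j = N := by omega
      exact ⟨σ, _, .whileLE_false (by simp [Expr.eval, h₁, h₂]), by simp [Expr.cost], hσ⟩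
    | succ q ih =>
      intro j hj σ hσ
      obtain ⟨h₁, h₂⟩ := hreg j σ hσ
      obtain ⟨τ, t, h3, h4, h5⟩ := hstep j (by omega) σ hσ
      obtain ⟨υ, u, k3, k4, k5⟩ := ih (j + 1) (by omega) τ h5
      refine ⟨υ, _, .whileLE_true (by simp [Expr.eval, h₁, h₂]; omega) h3 k3, ?_, k5⟩
      simp only [Expr.cost]
      linarith [Nat.succ_mul q (c + 5)]
  exact key N 0 (by omega) σ h0

/-- Primitive recursion as a counting loop: `O(size ^ d)` rounds of cost `O(size ^ a)` each. -/
theorem Computes.fold {B e₀ : X.Γ → ℕ} {f : (X.Γ × ℕ) × ℕ → ℕ} {C : ℕ}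
    (hB : Computes X B (a + d)) (h₀ : Computes X e₀ (a + d))
    (hC : ∀ γ ρ, X.regs γ ρ → B γ ≤ C * X.size γ ^ d)
    (hf : ∀ (r : ℕ) (hr : X.b ≤ r), Computes ((X.push r hr fun γ i => i < B γ).push (r + 1) le_rfl
      fun _ _ => True) f a) :
    Computes X (fun γ => Nat.rec (motive := fun _ => ℕ) (e₀ γ) (fun i acc => f ((γ, i), acc))
      (B γ)) (a + d) := by
  intro k hk
  obtain ⟨P₀, c₀, hP₀⟩ := h₀ (k + 2) (by omega)
  obtain ⟨Q, c₁, hQ⟩ := hB (k + 3) (by omega)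
  obtain ⟨P, c, hP⟩ := hf (k + 1) (by omega) (k + 4) (by simp only; omega)
  -- Registers from `k` on: the result, the counter, the accumulator, the bound, and the freshly
  -- computed value of `f`.
  refine ⟨.seq P₀ (.seq Q (.seq (.assign (k + 1) (.const 0)) (.seq
    (.whileLE (.add (.reg (k + 1)) (.const 1)) (.reg (k + 3)) (.seq P (.seq
      (.assign (k + 2) (.reg (k + 4))) (.assign (k + 1) (.add (.reg (k + 1)) (.const 1))))))
    (.assign k (.reg (k + 2)))))), c₀ + c₁ + C * (c + 11) + 9, fun γ σ h₁ h₂ => ?_⟩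
  obtain ⟨σ₁, t₁, r₁, l₁, m₁, f₁, v₁⟩ := hP₀ γ σ h₁ h₂
  obtain ⟨σ₂, t₂, r₂, l₂, m₂, f₂, v₂⟩ := hQ γ σ₁
    (X.regs_congr γ _ _ (fun x hx => f₁ x (by omega)) h₁) (by rw [m₁]; exact h₂)
  set F : ℕ → ℕ := fun j => Nat.rec (motive := fun _ => ℕ) (e₀ γ) (fun i acc => f ((γ, i), acc)) j
    with hF
  let inv : ℕ → Store → Prop := fun j υ => υ.mem = σ.mem ∧ (∀ x < k, υ.reg x = σ.reg x) ∧
    υ.reg (k + 1) = j ∧ υ.reg (k + 2) = F j ∧ υ.reg (k + 3) = B γ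
  have hn := X.one_le_pow γ a
  have hnd := X.one_le_pow γ d
  obtain ⟨σ₃, t₃, r₃, l₃, m₃, f₃, -, v₃, -⟩ := Runs.for_loop (i := k + 1) (b := k + 3) (N := B γ)
    (c := c * X.size γ ^ a + 6) (inv := inv)
    (P := .seq P (.seq
      (.assign (k + 2) (.reg (k + 4))) (.assign (k + 1) (.add (.reg (k + 1)) (.const 1)))))
    (fun j υ h => ⟨h.2.2.1, h.2.2.2.2⟩)
    (fun j hj υ h => by
      obtain ⟨i₁, i₂, i₃, i₄, i₅⟩ := h
      obtain ⟨ω, w, o₁, o₂, o₃, o₄, o₅⟩ := hP ((γ, j), F j) υ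
        ⟨⟨X.regs_congr γ _ _ (fun x hx => i₂ x (by omega)) h₁, i₃, hj⟩, i₄, trivial⟩
        (by rw [i₁]; exact h₂)
      refine ⟨_, _, .seq o₁ (.seq (.assign _ _ _) (.assign _ _ _)), ?_, ?_, ?_, ?_, ?_, ?_⟩
      · simp only [Expr.cost] at o₂ ⊢
        omega
      · exact o₃.trans i₁
      · intro x hx
        simp only
        rw [Function.update_of_ne (by omega), Function.update_of_ne (by omega), o₄ x (by omega),
          i₂ x hx]
      · simp [Expr.eval, o₄ (k + 1) (by omega), i₃]
      · simp [Expr.eval, o₅, hF]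
      · simp [o₄ (k + 3) (by omega), i₅])
    (σ := ⟨Function.update σ₂.reg (k + 1) 0, σ₂.mem⟩)
    ⟨m₂.trans m₁, fun x hx => by
      simp only
      rw [Function.update_of_ne (by omega), f₂ x (by omega), f₁ x (by omega)],
      by simp, by simp [f₂ (k + 2) (by omega), v₁, hF], by simp [v₂]⟩
  refine ⟨_, _, .seq r₁ (.seq r₂ (.seq (.assign _ _ _) (.seq r₃ (.assign _ _ _)))), ?_, m₃, ?_, ?_⟩
  · have hBγ := hC γ _ h₁
    simp only [Expr.cost]
    have e1 : B γ * (c * X.size γ ^ a + 6 + 5) ≤ (C * X.size γ ^ d) * ((c + 11) * X.size γ ^ a) :=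
      Nat.mul_le_mul hBγ (by nlinarith)
    have e2 : (C * X.size γ ^ d) * ((c + 11) * X.size γ ^ a) =
        C * (c + 11) * X.size γ ^ (a + d) := by rw [pow_add]; ring
    have e3 := X.one_le_pow γ (a + d)
    nlinarith
  · intro x hx
    simp only
    rw [Function.update_of_ne hx.ne, f₃ x hx]
  · simp [Expr.eval, v₃, hF]

theorem Computes.sum {B : X.Γ → ℕ} {f : X.Γ × ℕ → ℕ} {C : ℕ}
    (hB : Computes X B (a + d)) (hC : ∀ γ ρ, X.regs γ ρ → B γ ≤ C * X.size γ ^ d)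
    (hf : ∀ (r : ℕ) (hr : X.b ≤ r), Computes (X.push r hr fun γ i => i < B γ) f a) :
    Computes X (fun γ => ∑ i ∈ Finset.range (B γ), f (γ, i)) (a + d) := by
  refine (Computes.fold (f := fun g => g.2 + f g.1) hB (.const 0) hC
    fun r hr => Computes.top.add (hf r hr).pop).congr fun γ _ _ _ _ => ?_
  induction B γ with
  | zero => rfl
  | succ q ih => rw [Finset.sum_range_succ, ← ih]

/-- Multiplication is repeated addition, so only the first factor has to be bounded. -/
theorem Computes.mul {e f : X.Γ → ℕ} {C : ℕ} (he : Computes X e (a + d))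
    (hf : Computes X f (a + d)) (hC : ∀ γ ρ, X.regs γ ρ → e γ ≤ C * X.size γ ^ d) :
    Computes X (fun γ => e γ * f γ) (a + d) :=
  (Computes.bind (f := fun g => ∑ _i ∈ Finset.range (e g.1), g.2) hf fun r hr =>
    .sum (C := C) (f := fun g : (X.Γ × ℕ) × ℕ => g.1.2) he.pop (fun g ρ h => hC g.1 ρ h.1)
      fun r' hr' => Computes.top.pop).congr fun γ _ _ _ _ => by simp

/-! #### Decidable conditions -/

open Classical in
/-- Some program decides `p` in time `O(size ^ a)`. -/
def Decides (X : Ctx) (p : X.Γ → Prop) (a : ℕ) : Prop :=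
  Computes X (fun γ => if p γ then 1 else 0) a

theorem Decides.congr {p q : X.Γ → Prop} (h : Decides X p a)
    (hpq : ∀ γ ρ M, X.regs γ ρ → X.mem γ M → (p γ ↔ q γ)) : Decides X q a :=
  Computes.congr h fun γ ρ M h₁ h₂ => by
    congr 1; exact propext (hpq γ ρ M h₁ h₂)

theorem Decides.mono {p : X.Γ → Prop} (h : Decides X p a) (hd : a ≤ d) : Decides X p d :=
  Computes.mono h hd

theorem Decides.pop {p : X.Γ → Prop} (h : Decides X p a) {r : ℕ} {hr : X.b ≤ r}
    {D : X.Γ → ℕ → Prop} : Decides (X.push r hr D) (fun g => p g.1) a :=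
  Computes.pop h

theorem Decides.restrict {p : X.Γ → Prop} (h : Decides X p a) {q : X.Γ → Prop} :
    Decides (X.restrict q) p a :=
  Computes.restrict h

theorem Decides.le {e f : X.Γ → ℕ} (he : Computes X e a) (hf : Computes X f a) :
    Decides X (fun γ => e γ ≤ f γ) a :=
  (Computes.iteLE he hf (.const 1) (.const 0)).congr fun γ _ _ _ _ => by congr

open Classical in
theorem Computes.ite {p : X.Γ → Prop} {g h : X.Γ → ℕ} (hp : Decides X p a)
    (hg : Computes (X.restrict p) g a) (hh : Computes (X.restrict fun γ => ¬ p γ) h a) :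
    Computes X (fun γ => if p γ then g γ else h γ) a := by
  have key := Computes.iteLE (g := g) (h := h) (.const 1) hp
    (hg.comap (Y := X.restrict fun γ => 1 ≤ if p γ then 1 else 0) (fun γ => γ) le_rfl (fun _ => rfl)
      (fun γ ρ h => ⟨h.1, by by_contra hn; simpa [hn] using h.2⟩) fun _ _ _ _ h => h)
    (hh.comap (Y := X.restrict fun γ => ¬ 1 ≤ if p γ then 1 else 0) (fun γ => γ) le_rfl (fun _ => rfl)
      (fun γ ρ h => ⟨h.1, fun hn => by simp [hn] at h⟩) fun _ _ _ _ h => h)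
  refine key.congr fun γ _ _ _ _ => ?_
  by_cases hγ : p γ <;> simp [hγ]

theorem Decides.and {p q : X.Γ → Prop} (hp : Decides X p a) (hq : Decides (X.restrict p) q a) :
    Decides X (fun γ => p γ ∧ q γ) a :=
  (Computes.ite hp hq (.const 0)).congr fun γ _ _ _ _ => by
    by_cases h : p γ <;> by_cases h' : q γ <;> simp [h, h']

theorem Decides.not {p : X.Γ → Prop} (hp : Decides X p a) : Decides X (fun γ => ¬ p γ) a :=
  (Computes.ite hp (.const 0) (.const 1)).congr fun γ _ _ _ _ => by
    by_cases h : p γ <;> simp [h]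

theorem Decides.or {p q : X.Γ → Prop} (hp : Decides X p a) (hq : Decides X q a) :
    Decides X (fun γ => p γ ∨ q γ) a :=
  (hp.not.and hq.not.restrict).not.congr fun γ _ _ _ _ => by tauto

theorem Decides.imp {p q : X.Γ → Prop} (hp : Decides X p a) (hq : Decides (X.restrict p) q a) :
    Decides X (fun γ => p γ → q γ) a :=
  (hp.and hq.not).not.congr fun γ _ _ _ _ => by tauto

theorem Decides.lt {e f : X.Γ → ℕ} (he : Computes X e a) (hf : Computes X f a) :
    Decides X (fun γ => e γ < f γ) a :=
  (Decides.le hf he).not.congr fun γ _ _ _ _ => by simp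

theorem Decides.eq {e f : X.Γ → ℕ} (he : Computes X e a) (hf : Computes X f a) :
    Decides X (fun γ => e γ = f γ) a :=
  ((Decides.le he hf).and (Decides.le hf he).restrict).congr fun γ _ _ _ _ => by omega

/-- The loop counts all witnesses, and the count is then compared with 1. -/
theorem Decides.exists_lt {B : X.Γ → ℕ} {p : X.Γ × ℕ → Prop} {C : ℕ}
    (hB : Computes X B (a + d)) (hC : ∀ γ ρ, X.regs γ ρ → B γ ≤ C * X.size γ ^ d)
    (hp : ∀ (r : ℕ) (hr : X.b ≤ r), Decides (X.push r hr fun γ i => i < B γ) p a) :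
    Decides X (fun γ => ∃ i < B γ, p (γ, i)) (a + d) := by
  classical
  have key : Computes X (fun γ => ∑ i ∈ Finset.range (B γ), if p (γ, i) then 1 else 0) (a + d) :=
    Computes.sum (f := fun g => if p g then 1 else 0) hB hC fun r hr => (hp r hr : Computes _ _ _)
  refine (Decides.le (.const 1) key).congr fun γ _ _ _ _ => ?_
  rw [Finset.sum_boole, Nat.cast_id, Nat.one_le_iff_ne_zero, Finset.card_ne_zero]
  simp [Finset.Nonempty]

theorem Decides.forall_lt {B : X.Γ → ℕ} {p : X.Γ × ℕ → Prop} {C : ℕ}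
    (hB : Computes X B (a + d)) (hC : ∀ γ ρ, X.regs γ ρ → B γ ≤ C * X.size γ ^ d)
    (hp : ∀ (r : ℕ) (hr : X.b ≤ r), Decides (X.push r hr fun γ i => i < B γ) p a) :
    Decides X (fun γ => ∀ i < B γ, p (γ, i)) (a + d) := by
  have key : Decides X (fun γ => ∃ i < B γ, ¬ p (γ, i)) (a + d) :=
    Decides.exists_lt (p := fun g => ¬ p g) hB hC fun r hr => (hp r hr).not
  refine key.not.congr fun γ _ _ _ _ => ?_
  push Not
  rfl

open Classical in
/-- `i + 1` for the largest `i < B` with `p i`, and `0` if there is none. -/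
noncomputable def pick (B : ℕ) (p : ℕ → Prop) : ℕ :=
  Nat.rec (motive := fun _ => ℕ) 0 (fun i acc => if p i then i + 1 else acc) B

theorem pick_spec (B : ℕ) (p : ℕ → Prop) :
    (pick B p = 0 ∧ ∀ i < B, ¬ p i) ∨ ∃ i < B, pick B p = i + 1 ∧ p i := by
  induction B with
  | zero => left; simp [pick]
  | succ B ih =>
    by_cases h : p B
    · exact .inr ⟨B, by omega, by simp [pick, h], h⟩
    · have : pick (B + 1) p = pick B p := by simp [pick, h]
      rw [this]
      rcases ih with ⟨h₁, h₂⟩ | ⟨i, hi, h₁, h₂⟩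
      · exact .inl ⟨h₁, fun i hi => (Nat.lt_succ_iff_lt_or_eq.1 hi).elim (h₂ i) fun e => e ▸ h⟩
      · exact .inr ⟨i, by omega, h₁, h₂⟩

theorem one_le_pick_iff {B : ℕ} {p : ℕ → Prop} : 1 ≤ pick B p ↔ ∃ i < B, p i := by
  rcases pick_spec B p with ⟨h₁, h₂⟩ | ⟨i, hi, h₁, h₂⟩
  · simp only [h₁]
    constructor
    · omega
    · rintro ⟨i, hi, h⟩
      exact absurd h (h₂ i hi)
  · exact ⟨fun _ => ⟨i, hi, h₂⟩, fun _ => by omega⟩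

theorem pick_le (B : ℕ) (p : ℕ → Prop) : pick B p ≤ B := by
  rcases pick_spec B p with ⟨h₁, -⟩ | ⟨i, hi, h₁, -⟩ <;> omega

theorem pick_sub_one_spec {B : ℕ} {p : ℕ → Prop} (h : 1 ≤ pick B p) :
    pick B p - 1 < B ∧ p (pick B p - 1) := by
  rcases pick_spec B p with ⟨h₁, -⟩ | ⟨i, hi, h₁, h₂⟩
  · omega
  · rw [h₁]; exact ⟨hi, h₂⟩

/-- A single loop in which every later hit overwrites the accumulator. -/
theorem Computes.pick {B : X.Γ → ℕ} {p : X.Γ × ℕ → Prop} {C : ℕ}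
    (hB : Computes X B (a + d)) (hC : ∀ γ ρ, X.regs γ ρ → B γ ≤ C * X.size γ ^ d)
    (hp : ∀ (r : ℕ) (hr : X.b ≤ r), Decides (X.push r hr fun γ i => i < B γ) p a) :
    Computes X (fun γ => pick (B γ) fun i => p (γ, i)) (a + d) := by
  classical
  exact Computes.fold (f := fun g => if p g.1 then g.1.2 + 1 else g.2) hB (.const 0) hC
    fun r hr => .ite (hp r hr).pop (Computes.top.pop.add (.const 1)).restrict Computes.top.restrict

/-! #### Commands -/

theorem Executes.mono {post : X.Γ → (ℕ → ℕ) → Prop} (h : Executes X post a) (hd : a ≤ d) :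
    Executes X post d := by
  intro k hk
  obtain ⟨P, c, hP⟩ := h k hk
  refine ⟨P, c, fun γ σ h₁ h₂ => ?_⟩
  obtain ⟨τ, t, h3, h4, h5⟩ := hP γ σ h₁ h₂
  exact ⟨τ, t, h3, h4.trans (Nat.mul_le_mul_left _ (Nat.pow_le_pow_right (X.size_pos γ) hd)), h5⟩

theorem Executes.imp {post post' : X.Γ → (ℕ → ℕ) → Prop} (h : Executes X post a)
    (hpp : ∀ γ ρ M, X.regs γ ρ → post γ M → post' γ M) : Executes X post' a := by
  intro k hk
  obtain ⟨P, c, hP⟩ := h k hk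
  refine ⟨P, c, fun γ σ h₁ h₂ => ?_⟩
  obtain ⟨τ, t, h3, h4, h5, h6⟩ := hP γ σ h₁ h₂
  exact ⟨τ, t, h3, h4, h5, hpp γ _ _ h₁ h6⟩

theorem Executes.bind {e : X.Γ → ℕ} {post : X.Γ → (ℕ → ℕ) → Prop} (he : Computes X e a)
    (hf : ∀ (r : ℕ) (hr : X.b ≤ r), Executes (X.push r hr (fun γ x => x = e γ)) (fun g => post g.1) a) :
    Executes X post a := by
  intro k hk
  obtain ⟨P, c, hP⟩ := he k hk
  obtain ⟨Q, c', hQ⟩ := hf k hk (k + 1) le_rfl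
  refine ⟨.seq P Q, c + c', fun γ σ h₁ h₂ => ?_⟩
  obtain ⟨τ, t, h3, h4, h5, h6, h7⟩ := hP γ σ h₁ h₂
  obtain ⟨υ, u, k3, k4, k5, k6⟩ := hQ (γ, e γ) τ
    ⟨X.regs_congr γ _ _ (fun x hx => h6 x (by omega)) h₁, h7, rfl⟩ (by rw [h5]; exact h₂)
  refine ⟨_, _, .seq h3 k3, ?_, fun x hx => by rw [k5 x (by omega), h6 x hx], k6⟩
  simp only at k4
  nlinarith

theorem Executes.seq {post post' : X.Γ → (ℕ → ℕ) → Prop} (h : Executes X post a)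
    (h' : Executes (X.setMem post) post' a) : Executes X post' a := by
  intro k hk
  obtain ⟨P, c, hP⟩ := h k hk
  obtain ⟨Q, c', hQ⟩ := h' k hk
  refine ⟨.seq P Q, c + c', fun γ σ h₁ h₂ => ?_⟩
  obtain ⟨τ, t, h3, h4, h5, h6⟩ := hP γ σ h₁ h₂
  obtain ⟨υ, u, k3, k4, k5, k6⟩ := hQ γ τ
    (X.regs_congr γ _ _ (fun x hx => h5 x (by omega)) h₁) h6
  refine ⟨_, _, .seq h3 k3, ?_, fun x hx => by rw [k5 x hx, h5 x hx], k6⟩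
  simp only at k4
  nlinarith

theorem Executes.store {e v : X.Γ → ℕ} {post : X.Γ → (ℕ → ℕ) → Prop} (he : Computes X e a)
    (hv : Computes X v a)
    (hpost : ∀ γ ρ M, X.regs γ ρ → X.mem γ M → post γ (Function.update M (e γ) (v γ))) :
    Executes X post a := by
  intro k hk
  obtain ⟨P, c, hP⟩ := he k hk
  obtain ⟨Q, c', hQ⟩ := hv (k + 1) (by omega)
  refine ⟨.seq P (.seq Q (.store (.reg k) (.reg (k + 1)))), c + c' + 3, fun γ σ h₁ h₂ => ?_⟩
  obtain ⟨τ, t, h3, h4, h5, h6, h7⟩ := hP γ σ h₁ h₂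
  obtain ⟨υ, u, k3, k4, k5, k6, k7⟩ := hQ γ τ
    (X.regs_congr γ _ _ (fun x hx => h6 x (by omega)) h₁) (by rw [h5]; exact h₂)
  refine ⟨_, _, .seq h3 (.seq k3 (.store _ _ _)), ?_,
    fun x hx => by simp only; rw [k6 x (by omega), h6 x hx], ?_⟩
  · have := X.one_le_pow γ a
    simp only [Expr.cost]
    nlinarith
  · simp only [Expr.eval, k6 k (by omega), h7, k7, k5, h5]
    exact hpost γ _ _ h₁ h₂

theorem Executes.for {B : X.Γ → ℕ} {J : X.Γ → ℕ → (ℕ → ℕ) → Prop} {C : ℕ}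
    (hB : Computes X B (a + d)) (hC : ∀ γ ρ, X.regs γ ρ → B γ ≤ C * X.size γ ^ d)
    (h₀ : ∀ γ ρ M, X.regs γ ρ → X.mem γ M → J γ 0 M)
    (hf : ∀ (r : ℕ) (hr : X.b ≤ r), Executes ((X.push r hr fun γ i => i < B γ).setMem fun g => J g.1 g.2)
      (fun g => J g.1 (g.2 + 1)) a) :
    Executes X (fun γ => J γ (B γ)) (a + d) := by
  intro k hk
  obtain ⟨Q, c₁, hQ⟩ := hB (k + 1) (by omega)
  obtain ⟨P, c, hP⟩ := hf k hk (k + 2) (by simp only; omega)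
  refine ⟨.seq Q (.seq (.assign k (.const 0))
    (.whileLE (.add (.reg k) (.const 1)) (.reg (k + 1)) (.seq P
      (.assign k (.add (.reg k) (.const 1)))))), c₁ + C * (c + 9) + 7, fun γ σ h₁ h₂ => ?_⟩
  obtain ⟨σ₂, t₂, r₂, l₂, m₂, f₂, v₂⟩ := hQ γ σ h₁ h₂
  let inv : ℕ → Store → Prop := fun j υ => J γ j υ.mem ∧ (∀ x < k, υ.reg x = σ.reg x) ∧
    υ.reg k = j ∧ υ.reg (k + 1) = B γ
  have hn := X.one_le_pow γ a
  have hnd := X.one_le_pow γ d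
  obtain ⟨σ₃, t₃, r₃, l₃, m₃, f₃, -, -⟩ := Runs.for_loop (i := k) (b := k + 1) (N := B γ)
    (c := c * X.size γ ^ a + 4) (inv := inv)
    (P := .seq P (.assign k (.add (.reg k) (.const 1))))
    (fun j υ h => ⟨h.2.2.1, h.2.2.2⟩)
    (fun j hj υ h => by
      obtain ⟨i₁, i₂, i₃, i₄⟩ := h
      obtain ⟨ω, w, o₁, o₂, o₃, o₄⟩ := hP (γ, j) υ
        ⟨X.regs_congr γ _ _ (fun x hx => i₂ x (by omega)) h₁, i₃, hj⟩ i₁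
      refine ⟨_, _, .seq o₁ (.assign _ _ _), ?_, o₄, ?_, ?_, ?_⟩
      · simp only [Expr.cost] at o₂ ⊢
        omega
      · intro x hx
        simp only
        rw [Function.update_of_ne (by omega), o₃ x (by omega), i₂ x hx]
      · simp [Expr.eval, o₃ k (by omega), i₃]
      · simp [o₃ (k + 1) (by omega), i₄])
    (σ := ⟨Function.update σ₂.reg k 0, σ₂.mem⟩)
    ⟨by simp only; rw [m₂]; exact h₀ γ _ _ h₁ h₂, fun x hx => by
      simp only
      rw [Function.update_of_ne (by omega), f₂ x (by omega)],
      by simp, by simp [v₂]⟩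
  refine ⟨_, _, .seq r₂ (.seq (.assign _ _ _) r₃), ?_, f₃, m₃⟩
  have hBγ := hC γ _ h₁
  simp only [Expr.cost]
  have e1 : B γ * (c * X.size γ ^ a + 4 + 5) ≤ (C * X.size γ ^ d) * ((c + 9) * X.size γ ^ a) :=
    Nat.mul_le_mul hBγ (by nlinarith)
  have e2 : (C * X.size γ ^ d) * ((c + 9) * X.size γ ^ a) =
      C * (c + 9) * X.size γ ^ (a + d) := by rw [pow_add]; ring
  have e3 := X.one_le_pow γ (a + d)
  nlinarith

end Hotelling

/-! ### Utilities depend on comparisons only -/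

namespace Hotelling

theorem leftMean_insert (A : Finset ℝ) (y : ℝ) : leftMean (insert y A) y = leftMean A y := by
  simp [leftMean, Finset.filter_insert]

theorem rightMean_insert (A : Finset ℝ) (y : ℝ) : rightMean (insert y A) y = rightMean A y := by
  simp [rightMean, Finset.filter_insert]

theorem Instance.util_insert (I : Instance) (A : Finset ℝ) (y : ℝ) :
    I.util (insert y A) y = I.util A y := by
  simp only [Instance.util, leftMean_insert, rightMean_insert]

/-- The nearest left rival gives the largest mean, so it may be replaced by all left rivals; without
any, both sides hold. This and the next three lemmas eliminate `max` and `min` in favour of plain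
comparisons. -/
theorem leftMean_le_iff (A : Finset ℝ) (y q : ℝ) :
    leftMean A y ≤ (q : WithBot ℝ) ↔ ∀ l ∈ A, l < y → l + y ≤ 2 * q := by
  rw [leftMean]
  rcases h : (A.filter (· < y)).max with _ | x
  · have h' : A.filter (· < y) = ∅ := Finset.max_eq_bot.1 h
    refine ⟨fun _ l hl hly => ?_, fun _ => bot_le⟩
    have : l ∈ A.filter (· < y) := by simp [hl, hly]
    simp [h'] at this
  · have hx := Finset.mem_filter.1 (Finset.mem_of_max h)
    change ((((x + y) / 2 : ℝ) : WithBot ℝ)) ≤ _ ↔ _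
    rw [WithBot.coe_le_coe]
    refine ⟨fun hq l hl hly => ?_, fun hq => by linarith [hq x hx.1 hx.2]⟩
    have := Finset.le_max_of_eq (show l ∈ A.filter (· < y) by simp [hl, hly]) h
    linarith

theorem eq_leftMean_iff (A : Finset ℝ) (y q : ℝ) :
    (q : WithBot ℝ) = leftMean A y ↔
      (∀ l ∈ A, l < y → l + y ≤ 2 * q) ∧ ∃ l ∈ A, l < y ∧ l + y = 2 * q := by
  rw [← leftMean_le_iff, leftMean]
  rcases h : (A.filter (· < y)).max with _ | x
  · have h' : A.filter (· < y) = ∅ := Finset.max_eq_bot.1 h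
    constructor
    · intro hq; exact (WithBot.coe_ne_bot hq).elim
    rintro ⟨-, l, hl, hly, -⟩
    have : l ∈ A.filter (· < y) := by simp [hl, hly]
    simp [h'] at this
  · have hx := Finset.mem_filter.1 (Finset.mem_of_max h)
    change _ = ((((x + y) / 2 : ℝ) : WithBot ℝ)) ↔ ((((x + y) / 2 : ℝ) : WithBot ℝ)) ≤ _ ∧ _
    rw [WithBot.coe_le_coe, WithBot.coe_inj]
    refine ⟨fun hq => ⟨hq.ge, x, hx.1, hx.2, by linarith⟩, ?_⟩
    rintro ⟨hq, l, hl, hly, e⟩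
    have := Finset.le_max_of_eq (show l ∈ A.filter (· < y) by simp [hl, hly]) h
    linarith

theorem le_rightMean_iff (A : Finset ℝ) (y q : ℝ) :
    (q : WithTop ℝ) ≤ rightMean A y ↔ ∀ r ∈ A, y < r → 2 * q ≤ r + y := by
  rw [rightMean]
  rcases h : (A.filter (y < ·)).min with _ | x
  · have h' : A.filter (y < ·) = ∅ := Finset.min_eq_top.1 h
    refine ⟨fun _ l hl hly => ?_, fun _ => le_top⟩
    have : l ∈ A.filter (y < ·) := by simp [hl, hly]
    simp [h'] at this
  · have hx := Finset.mem_filter.1 (Finset.mem_of_min h)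
    change _ ≤ ((((y + x) / 2 : ℝ) : WithTop ℝ)) ↔ _
    rw [WithTop.coe_le_coe]
    refine ⟨fun hq l hl hly => ?_, fun hq => by linarith [hq x hx.1 hx.2]⟩
    have := Finset.min_le_of_eq (show l ∈ A.filter (y < ·) by simp [hl, hly]) h
    linarith

theorem eq_rightMean_iff (A : Finset ℝ) (y q : ℝ) :
    (q : WithTop ℝ) = rightMean A y ↔
      (∀ r ∈ A, y < r → 2 * q ≤ r + y) ∧ ∃ r ∈ A, y < r ∧ r + y = 2 * q := by
  rw [← le_rightMean_iff, rightMean]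
  rcases h : (A.filter (y < ·)).min with _ | x
  · have h' : A.filter (y < ·) = ∅ := Finset.min_eq_top.1 h
    constructor
    · intro hq; exact (WithTop.coe_ne_top hq).elim
    rintro ⟨-, l, hl, hly, -⟩
    have : l ∈ A.filter (y < ·) := by simp [hl, hly]
    simp [h'] at this
  · have hx := Finset.mem_filter.1 (Finset.mem_of_min h)
    change _ = ((((y + x) / 2 : ℝ) : WithTop ℝ)) ↔ _ ≤ ((((y + x) / 2 : ℝ) : WithTop ℝ)) ∧ _
    rw [WithTop.coe_le_coe, WithTop.coe_inj]
    refine ⟨fun hq => ⟨hq.le, x, hx.1, hx.2, by linarith⟩, ?_⟩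
    rintro ⟨hq, l, hl, hly, e⟩
    have := Finset.min_le_of_eq (show l ∈ A.filter (y < ·) by simp [hl, hly]) h
    linarith

/-- The utility at `y` against the rivals `x j` is determined by comparisons. -/
theorem Instance.util_image_congr (I : Instance) {ι : Type*} (T : Finset ι) {x x' : ι → ℝ}
    {y y' : ℝ}
    (hlt : ∀ j ∈ T, (x j < y ↔ x' j < y')) (hgt : ∀ j ∈ T, (y < x j ↔ y' < x' j))
    (hadd : ∀ j ∈ T, ∀ p ∈ I.voters, (2 * (p : ℝ) - x j < y ↔ 2 * (p : ℝ) - x' j < y'))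
    (hadd' : ∀ j ∈ T, ∀ p ∈ I.voters, (y < 2 * (p : ℝ) - x j ↔ y' < 2 * (p : ℝ) - x' j)) :
    I.util (T.image x) y = I.util (T.image x') y' := by
  -- The side of the mean of `x j` and `y` on which `p` lies is decided by comparing `y` with the
  -- reflection `2p - x j`.
  have hle : ∀ p ∈ I.voters, ∀ j ∈ T, (x j + y ≤ 2 * (p : ℝ) ↔ x' j + y' ≤ 2 * (p : ℝ)) := by
    intro p hp j hj
    rw [← not_iff_not, not_le, not_le, ← sub_lt_iff_lt_add', ← sub_lt_iff_lt_add', hadd j hj p hp]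
  have hge : ∀ p ∈ I.voters, ∀ j ∈ T, (2 * (p : ℝ) ≤ x j + y ↔ 2 * (p : ℝ) ≤ x' j + y') := by
    intro p hp j hj
    rw [← not_iff_not, not_le, not_le, ← lt_sub_iff_add_lt', ← lt_sub_iff_add_lt', hadd' j hj p hp]
  have heq : ∀ p ∈ I.voters, ∀ j ∈ T, (x j + y = 2 * (p : ℝ) ↔ x' j + y' = 2 * (p : ℝ)) := by
    intro p hp j hj
    rw [le_antisymm_iff, le_antisymm_iff, hle p hp j hj, hge p hp j hj]
  have hall {P Q P' Q' : ι → Prop} (h : ∀ j ∈ T, (P j ↔ P' j)) (h' : ∀ j ∈ T, (Q j ↔ Q' j)) :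
      ((∀ j ∈ T, P j → Q j) ↔ ∀ j ∈ T, P' j → Q' j) :=
    forall₂_congr fun j hj => by rw [h j hj, h' j hj]
  have hex {P Q P' Q' : ι → Prop} (h : ∀ j ∈ T, (P j ↔ P' j)) (h' : ∀ j ∈ T, (Q j ↔ Q' j)) :
      ((∃ j ∈ T, P j ∧ Q j) ↔ ∃ j ∈ T, P' j ∧ Q' j) :=
    exists_congr fun j => and_congr_right fun hj => by rw [h j hj, h' j hj]
  simp only [Instance.util]
  congr 1
  · congr 1
    · refine Finset.sum_congr (Finset.filter_congr fun p hp => ?_) fun _ _ => rfl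
      simp only [leftMean_le_iff, le_rightMean_iff, Finset.forall_mem_image]
      rw [hall hlt (hle p hp), hall hgt (hge p hp)]
    · congr 1
      refine Finset.sum_congr (Finset.filter_congr fun p hp => ?_) fun _ _ => rfl
      simp only [eq_leftMean_iff, Finset.forall_mem_image, Finset.exists_mem_image]
      rw [hall hlt (hle p hp), hex hlt (heq p hp)]
  · congr 1
    refine Finset.sum_congr (Finset.filter_congr fun p hp => ?_) fun _ _ => rfl
    simp only [eq_rightMean_iff, Finset.forall_mem_image, Finset.exists_mem_image]
    rw [hall hgt (hge p hp), hex hgt (heq p hp)]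

/-- The positions of the candidates other than `i`. -/
noncomputable def rivals {m : ℕ} (s : Fin m → ℝ) (i : Fin m) : Finset ℝ :=
  (Finset.univ.erase i).image s

theorem occupied_update {m : ℕ} (s : Fin m → ℝ) (i : Fin m) (y : ℝ) :
    occupied (Function.update s i y) = insert y (rivals s i) := by
  ext x
  simp only [occupied, rivals, Finset.mem_image, Finset.mem_univ, true_and, Finset.mem_insert,
    Finset.mem_erase, and_true]
  constructor
  · rintro ⟨j, rfl⟩
    by_cases h : j = i
    · left; subst h; simp
    · right; exact ⟨j, h, by simp [h]⟩
  · rintro (rfl | ⟨j, h, rfl⟩)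
    · exact ⟨i, by simp⟩
    · exact ⟨j, by simp [h]⟩

/-- Neighbours are defined by strict inequalities, so a candidate's own position does not influence
her means. Both sides of the comparison then refer to the same set of rivals, which a deviation does
not change. -/
theorem Instance.isEquilibrium_iff (I : Instance) (s : Fin I.m → ℝ) :
    I.IsEquilibrium s ↔ I.IsProfile s ∧ ∀ i, ∀ y ∈ Set.Icc (0 : ℝ) I.R, (∀ j, j ≠ i → y ≠ s j) →
      I.util (rivals s i) y ≤ I.util (rivals s i) (s i) := by
  refine and_congr_right fun _ => forall_congr' fun i => forall₃_congr fun y _ _ => ?_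
  have : occupied s = insert (s i) (rivals s i) := by
    rw [← occupied_update, Function.update_eq_self]
  rw [occupied_update, this, I.util_insert, I.util_insert]

/-- Pulls a deviation `y'` back along `φ`: either `y'` is the image of a point of `B`, or it splits
the image, and some real number splits the finite set `B` in the same way. -/
theorem Finset.exists_compare {B : Finset ℝ} {φ : ℝ → ℝ} (hφ : StrictMonoOn φ B) (y' : ℝ) :
    ∃ y, ∀ x ∈ B, (x < y ↔ φ x < y') ∧ (y < x ↔ y' < φ x) := by
  by_cases h : ∃ x ∈ B, φ x = y'
  · obtain ⟨y, hy, rfl⟩ := h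
    exact ⟨y, fun x hx => ⟨(hφ.lt_iff_lt hx hy).symm, (hφ.lt_iff_lt hy hx).symm⟩⟩
  · push Not at h
    obtain ⟨y, h₁, h₂⟩ := Order.exists_between_finsets (B.filter (φ · < y')) (B.filter (y' < φ ·))
      fun a ha b hb => by
        simp only [Finset.mem_filter] at ha hb
        exact (hφ.lt_iff_lt ha.1 hb.1).1 (ha.2.trans hb.2)
    refine ⟨y, fun x hx => ?_⟩
    rcases lt_or_gt_of_ne (h x hx) with hlt | hgt
    · have := h₁ x (by simp [hx, hlt])
      exact ⟨by simp [this, hlt], by simp [not_lt.2 this.le, not_lt.2 hlt.le]⟩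
    · have := h₂ x (by simp [hx, hgt])
      exact ⟨by simp [not_lt.2 this.le, not_lt.2 hgt.le], by simp [this, hgt]⟩

/-- Moving the candidates by a map that preserves the relevant comparisons. -/
theorem Instance.IsEquilibrium.comp {I : Instance} {s : Fin I.m → ℝ} (hs : I.IsEquilibrium s)
    {φ : ℝ → ℝ} {B : Set ℝ} (hφ : StrictMonoOn φ B) (h0 : (0 : ℝ) ∈ B) (hR : (I.R : ℝ) ∈ B)
    (φ0 : φ 0 = 0) (φR : φ I.R = I.R) (hsB : ∀ i, s i ∈ B)
    (hpB : ∀ i, ∀ p ∈ I.voters, 2 * (p : ℝ) - s i ∈ B)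
    (φp : ∀ i, ∀ p ∈ I.voters, φ (2 * (p : ℝ) - s i) = 2 * (p : ℝ) - φ (s i)) :
    I.IsEquilibrium (fun i => φ (s i)) := by
  classical
  rw [I.isEquilibrium_iff] at hs ⊢
  obtain ⟨⟨hinj, hmem⟩, heq⟩ := hs
  refine ⟨⟨fun i j h => hinj (hφ.injOn (hsB i) (hsB j) h), fun i => ⟨?_, ?_⟩⟩, ?_⟩
  · rw [← φ0]; exact hφ.monotoneOn h0 (hsB i) (hmem i).1
  · rw [← φR]; exact hφ.monotoneOn (hsB i) hR (hmem i).2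
  intro i y' hy' hne
  -- All points whose comparison with a deviation matters: positions and reflections determine the
  -- utility, and the endpoints keep the pulled-back deviation in `[0, R]`.
  set B' : Finset ℝ := {0, (I.R : ℝ)} ∪ Finset.univ.image s ∪
    (Finset.univ ×ˢ I.voters).image (fun q => 2 * (q.2 : ℝ) - s q.1) with hB'
  have hBB : (B' : Set ℝ) ⊆ B := by
    intro x hx
    simp only [hB', Finset.coe_union, Finset.coe_insert, Finset.coe_singleton, Finset.coe_image,
      Set.mem_union, Set.mem_insert_iff, Set.mem_singleton_iff, Set.mem_image, Finset.mem_coe,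
      Finset.mem_product] at hx
    rcases hx with ((rfl | rfl) | ⟨j, -, rfl⟩) | ⟨q, hq, rfl⟩
    exacts [h0, hR, hsB j, hpB _ _ hq.2]
  have mem0 : (0 : ℝ) ∈ B' := by simp [hB']
  have memR : (I.R : ℝ) ∈ B' := by simp [hB']
  have mems (j) : s j ∈ B' := by simp [hB']
  have memp (j) (p) (hp : p ∈ I.voters) : 2 * (p : ℝ) - s j ∈ B' :=
    Finset.mem_union_right _ (Finset.mem_image.2 ⟨(j, p), by simp [hp], rfl⟩)
  obtain ⟨y, hy⟩ := Finset.exists_compare (hφ.mono hBB) y'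
  have key : I.util (rivals s i) y = I.util (rivals (fun i => φ (s i)) i) y' :=
    I.util_image_congr _ (fun j _ => (hy _ (mems j)).1) (fun j _ => (hy _ (mems j)).2)
      (fun j _ p hp => by rw [← φp j p hp]; exact (hy _ (memp j p hp)).1)
      (fun j _ p hp => by rw [← φp j p hp]; exact (hy _ (memp j p hp)).2)
  have key' : I.util (rivals s i) (s i) = I.util (rivals (fun i => φ (s i)) i) (φ (s i)) :=
    I.util_image_congr _ (fun j _ => (hφ.lt_iff_lt (hsB j) (hsB i)).symm)
      (fun j _ => (hφ.lt_iff_lt (hsB i) (hsB j)).symm)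
      (fun j _ p hp => by rw [← φp j p hp]; exact (hφ.lt_iff_lt (hpB j p hp) (hsB i)).symm)
      (fun j _ p hp => by rw [← φp j p hp]; exact (hφ.lt_iff_lt (hsB i) (hpB j p hp)).symm)
  rw [← key, ← key']
  -- The pulled-back point is admissible: leaving `[0, R]` or hitting a rival would transfer to
  -- `y'`.
  refine heq i y ⟨not_lt.1 fun h => ?_, not_lt.1 fun h => ?_⟩ fun j hj e => ?_
  · have := ((hy 0 mem0).2.1 h); rw [φ0] at this; exact absurd hy'.1 (not_le.2 this)
  · have := ((hy _ memR).1.1 h); rw [φR] at this; exact absurd hy'.2 (not_le.2 this)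
  · have h := hy _ (mems j)
    rw [e] at h
    simp only [lt_irrefl, false_iff, not_lt] at h
    exact hne j hj (le_antisymm h.1 h.2)

/-! ### Discretization -/

/-- The distance to the nearest even integer. -/
noncomputable def fold (x : ℝ) : ℝ := if Even ⌊x⌋ then Int.fract x else 1 - Int.fract x

/-- The map of the line that commutes with the reflections at all integers and is `ρ` on `[0, 1]`. -/
noncomputable def unfold (ρ : ℝ → ℝ) (x : ℝ) : ℝ :=
  if Even ⌊x⌋ then ⌊x⌋ + ρ (fold x) else ⌊x⌋ + 1 - ρ (fold x)

theorem fold_mem_Icc (x : ℝ) : fold x ∈ Set.Icc (0 : ℝ) 1 := by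
  have h₁ := Int.fract_nonneg x
  have h₂ := (Int.fract_lt_one x).le
  unfold fold
  split_ifs
  · exact ⟨h₁, h₂⟩
  · constructor <;> linarith

theorem fold_intCast (n : ℤ) : fold n = 0 ∨ fold n = 1 := by
  unfold fold
  split_ifs <;> simp

section unfold

variable {ρ : ℝ → ℝ} (h0 : ρ 0 = 0) (h1 : ρ 1 = 1)

include h0 h1 in
theorem unfold_intCast (n : ℤ) : unfold ρ n = n := by
  simp only [unfold, fold, Int.floor_intCast, Int.fract_intCast]
  split_ifs <;> simp [h0, h1]

theorem floor_two_mul_sub {x : ℝ} (hx : ∀ n : ℤ, x ≠ n) (p : ℤ) :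
    ⌊2 * (p : ℝ) - x⌋ = 2 * p - ⌊x⌋ - 1 := by
  rw [Int.floor_eq_iff]
  have h₁ := Int.floor_le x
  have h₂ := Int.lt_floor_add_one x
  have h₃ := lt_of_le_of_ne h₁ (hx ⌊x⌋).symm
  push_cast
  constructor <;> linarith

/-- Off the integers, a reflection flips the parity of the unit cell and replaces the fractional
part by its complement, and these two changes cancel. Integers are separate because their floor
reflects without the shift by one. -/
theorem fold_two_mul_sub (x : ℝ) (p : ℤ) : fold (2 * (p : ℝ) - x) = fold x := by
  by_cases hx : ∃ n : ℤ, x = n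
  · obtain ⟨n, rfl⟩ := hx
    have : 2 * (p : ℝ) - n = ((2 * p - n : ℤ) : ℝ) := by push_cast; ring
    rw [this]
    simp only [fold, Int.floor_intCast, Int.fract_intCast]
    have : Even (2 * p - n) ↔ Even n := by simp [Int.even_sub]
    simp only [this]
  · push Not at hx
    have hf := floor_two_mul_sub hx p
    have he : Even (2 * p - ⌊x⌋ - 1) ↔ ¬ Even ⌊x⌋ := by
      rw [Int.even_sub_one, Int.even_sub]; simp
    simp only [fold, Int.fract, hf, he]
    split_ifs <;> push_cast <;> ring

include h0 h1 in
theorem unfold_two_mul_sub (x : ℝ) (p : ℤ) :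
    unfold ρ (2 * (p : ℝ) - x) = 2 * (p : ℝ) - unfold ρ x := by
  by_cases hx : ∃ n : ℤ, x = n
  · obtain ⟨n, rfl⟩ := hx
    have : 2 * (p : ℝ) - n = ((2 * p - n : ℤ) : ℝ) := by push_cast; ring
    rw [unfold_intCast h0 h1, this, unfold_intCast h0 h1]
  · push Not at hx
    have hf := floor_two_mul_sub hx p
    have he : Even (2 * p - ⌊x⌋ - 1) ↔ ¬ Even ⌊x⌋ := by
      rw [Int.even_sub_one, Int.even_sub]; simp
    simp only [unfold, fold_two_mul_sub, hf, he]
    split_ifs <;> push_cast <;> ring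

include h0 h1 in
-- Every cell `[n, n + 1)` is mapped into itself, so points of different cells keep their order.
-- Within an odd cell the order is reversed twice, by `fold` and by the sign in front of `ρ`.
theorem strictMonoOn_unfold {V : Set ℝ} (hV0 : 0 ∈ V) (hV1 : 1 ∈ V)
    (hρ : StrictMonoOn ρ V) : StrictMonoOn (unfold ρ) {x | fold x ∈ V} := by
  have bounds : ∀ x, fold x ∈ V → (⌊x⌋ : ℝ) ≤ unfold ρ x ∧ unfold ρ x < ⌊x⌋ + 1 := by
    intro x hx
    have hI := fold_mem_Icc x
    have l := hρ.monotoneOn hV0 hx hI.1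
    have u := hρ.monotoneOn hx hV1 hI.2
    have h₁ := Int.fract_lt_one x
    have h₂ := Int.fract_nonneg x
    unfold unfold
    split_ifs with he
    · have : fold x < 1 := by simpa [fold, he] using h₁
      have := hρ hx hV1 this
      constructor <;> linarith
    · have : 0 < fold x := by simp only [fold, he, if_false]; linarith
      have := hρ hV0 hx this
      constructor <;> linarith
  intro x hx y hy hxy
  rcases (Int.floor_mono hxy.le).lt_or_eq with h | h
  · have : (⌊x⌋ : ℝ) + 1 ≤ ⌊y⌋ := by exact_mod_cast h
    linarith [(bounds x hx).2, (bounds y hy).1]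
  · have hfr : Int.fract x < Int.fract y := by simp only [Int.fract, h]; linarith
    unfold unfold
    rw [h]
    split_ifs with he
    · have : fold x < fold y := by simpa [fold, he, h] using hfr
      linarith [hρ hx hy this]
    · have : fold y < fold x := by simpa [fold, he, h] using hfr
      linarith [hρ hy hx this]

end unfold

/-- If there is an equilibrium then there is one at multiples of `1 / 2 ^ m`. -/
theorem Instance.IsEquilibrium.exists_grid {I : Instance} {s : Fin I.m → ℝ}
    (hs : I.IsEquilibrium s) :
    ∃ g : Fin I.m → ℕ, I.IsEquilibrium (fun i => (g i : ℝ) / 2 ^ I.m) := by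
  classical
  set V : Finset ℝ := (Finset.univ.image fun i => fold (s i)).filter fun t => 0 < t ∧ t < 1 with hV
  have hcard : V.card < 2 ^ I.m :=
    ((Finset.card_filter_le _ _).trans (Finset.card_image_le.trans (by simp))).trans_lt
      (Nat.lt_two_pow_self (n := I.m))
  have hpos : (0 : ℝ) < 2 ^ I.m := by positivity
  -- The rank of `t` among the inner folded positions, except that `1` gets `2 ^ m` so that `ρ`
  -- fixes it. Monotonicity needs only `V.card ≤ m < 2 ^ m`.
  set N : ℝ → ℕ := fun t => if t = 1 then 2 ^ I.m else (V.filter (· ≤ t)).card with hN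
  set ρ : ℝ → ℝ := fun t => (N t : ℝ) / 2 ^ I.m with hρ
  have hV' : ∀ t ∈ V, 0 < t ∧ t < 1 := fun t ht => (Finset.mem_filter.1 ht).2
  have h0 : ρ 0 = 0 := by
    have : V.filter (· ≤ 0) = ∅ :=
      Finset.filter_eq_empty_iff.2 fun t ht => not_le.2 (hV' t ht).1
    simp [hρ, hN, this]
  have h1 : ρ 1 = 1 := by simp [hρ, hN]
  have hmono : StrictMonoOn ρ (insert 0 (insert 1 (V : Set ℝ))) := by
    intro x hx y hy hxy
    have hx1 : x ≠ 1 := by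
      rintro rfl
      rcases hy with rfl | rfl | hy
      · linarith
      · linarith
      · linarith [(hV' y hy).2]
    refine div_lt_div_of_pos_right (Nat.cast_lt.2 ?_) hpos
    by_cases hy1 : y = 1
    · simp only [hN, hx1, hy1, if_true, if_false]
      exact (Finset.card_filter_le _ _).trans_lt hcard
    · simp only [hN, hx1, hy1, if_false]
      have hyV : y ∈ V := by
        rcases hy with rfl | rfl | hy
        · rcases hx with rfl | rfl | hx
          · linarith
          · linarith
          · linarith [(hV' x hx).1]
        · exact absurd rfl hy1
        · exact hy
      refine Finset.card_lt_card ⟨fun t ht => ?_, fun hsub => ?_⟩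
      · simp only [Finset.mem_filter] at ht ⊢
        exact ⟨ht.1, ht.2.trans hxy.le⟩
      · have := hsub (Finset.mem_filter.2 ⟨hyV, le_rfl⟩)
        exact absurd (Finset.mem_filter.1 this).2 (not_le.2 hxy)
  have hB := strictMonoOn_unfold h0 h1 (by simp) (by simp) hmono
  have hint : ∀ n : ℕ, fold (n : ℝ) ∈ insert (0 : ℝ) (insert 1 (V : Set ℝ)) := by
    intro n
    rcases fold_intCast (n : ℤ) with h | h <;> rw [Int.cast_natCast] at h <;> simp [h]
  have φnat : ∀ n : ℕ, unfold ρ n = n := fun n => by simpa using unfold_intCast h0 h1 (n : ℤ)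
  have hsB : ∀ i, fold (s i) ∈ insert (0 : ℝ) (insert 1 (V : Set ℝ)) := by
    intro i
    obtain ⟨l, u⟩ := fold_mem_Icc (s i)
    rcases l.eq_or_lt with h | h
    · simp [← h]
    · rcases u.eq_or_lt with h' | h'
      · simp [h']
      · have : fold (s i) ∈ V := by simp [hV, h, h']
        simp [this]
  have hfin := hs.comp hB (by simpa using hint 0) (hint I.R) (by simpa using φnat 0) (φnat I.R)
    hsB (fun i p _ => by
      simpa only [Set.mem_ofPred_eq, Int.cast_natCast] using
        (fold_two_mul_sub (s i) (p : ℤ)).symm ▸ hsB i)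
    (fun i p _ => by simpa using unfold_two_mul_sub h0 h1 (s i) (p : ℤ))
  -- The new positions are integers plus or minus a rank divided by `2 ^ m`; the numerator is
  -- natural because they lie in `[0, R]`.
  have hgrid : ∀ i, ∃ g : ℕ, unfold ρ (s i) = (g : ℝ) / 2 ^ I.m := by
    intro i
    have hz : ∃ z : ℤ, unfold ρ (s i) = (z : ℝ) / 2 ^ I.m := by
      by_cases he : Even ⌊s i⌋
      · refine ⟨⌊s i⌋ * 2 ^ I.m + N (fold (s i)), ?_⟩
        simp only [unfold, he, if_true, hρ]
        push_cast
        field_simp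
      · refine ⟨(⌊s i⌋ + 1) * 2 ^ I.m - N (fold (s i)), ?_⟩
        simp only [unfold, he, if_false, hρ]
        push_cast
        field_simp
    obtain ⟨z, hz⟩ := hz
    have hnn := (hfin.1.2 i).1
    simp only [hz] at hnn
    have : (0 : ℝ) ≤ z := by
      by_contra hneg
      exact absurd hnn (not_le.2 (div_neg_of_neg_of_pos (not_le.1 hneg) hpos))
    lift z to ℕ using by exact_mod_cast this
    exact ⟨z, by simpa using hz⟩
  choose g hg using hgrid
  exact ⟨g, by simpa only [hg] using hfin⟩

end Hotelling

/-! ### Equilibria on the grid and the dynamic program -/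

namespace Hotelling

namespace Instance

/-- The number of grid steps of length `1 / 2 ^ m` in `[0, R]`. -/
def len (I : Instance) : ℕ := I.R * 2 ^ I.m

/-- Twice the coordinate of a voter position; coordinates measure multiples of `1 / 2 ^ (m + 1)`, and
the interval `[0, R]` starts at the coordinate `2 * len + 2`. -/
def loc (I : Instance) (p : ℕ) : ℕ := 4 * (I.len + 1) + 4 * (2 ^ I.m * p)

/-- Twice the number of voters to the left of a mean (the sum of two coordinates), voters at the
mean counted half. -/
def cum (I : Instance) (x : ℕ) : ℕ :=
  ∑ p ∈ I.voters, ((if I.loc p < x then I.F p else 0) + if I.loc p ≤ x then I.F p else 0)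

/-- Twice the utility at the coordinate `y` between the neighbours `a` and `b`. -/
def pay (I : Instance) (a y b : ℕ) : ℕ := I.cum (y + 2 * b) - I.cum (2 * a + y)

/-- The right neighbour of the rightmost candidate; the left neighbour of the leftmost one is `0`. -/
def last (I : Instance) : ℕ := 3 * I.len + 2

/-- The point with coordinate `w`. -/
noncomputable def coord (I : Instance) (w : ℕ) : ℝ := ((w : ℝ) - (2 * I.len + 2)) / (2 * 2 ^ I.m)

/-- A grid point or the right sentinel. -/
def Slot (I : Instance) (c : ℕ) : Prop := (I.len + 1 ≤ c ∧ c ≤ 2 * I.len + 1) ∨ c = I.last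

/-- The conditions on three consecutive candidates: the middle one has utility at least `T`, no
deviation into the gaps between them yields more than `T`, and the middle one cannot gain by moving
between her neighbours. -/
def Ok (I : Instance) (T a b c : ℕ) : Prop :=
  a < b ∧ b < c ∧ T ≤ I.pay a (2 * b) c ∧ ∀ y < 4 * I.len + 3, 2 * I.len + 2 ≤ y →
    (2 * a < y ∧ y < 2 * b → I.pay a y b ≤ T) ∧ (2 * b < y ∧ y < 2 * c → I.pay b y c ≤ T) ∧
      (2 * a < y ∧ y < 2 * c → I.pay a y c ≤ I.pay a (2 * b) c)

/-! ### Integer coordinates, sentinels and payoffs -/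

variable {I : Instance}

theorem len_eq (I : Instance) : (I.len : ℝ) = I.R * 2 ^ I.m := by simp [len]

theorem cum_mono : Monotone I.cum := fun x y h => Finset.sum_le_sum fun p _ => by
  split_ifs <;> omega

theorem coord_strictMono : StrictMono I.coord := fun x y h => by
  unfold coord
  have : (x : ℝ) < y := by exact_mod_cast h
  gcongr

theorem coord_two_mul (c : ℕ) : I.coord (2 * c) = ((c : ℝ) - (I.len + 1)) / 2 ^ I.m := by
  unfold coord
  push_cast
  field_simp

theorem coord_nonneg {w : ℕ} : 0 ≤ I.coord w ↔ 2 * I.len + 2 ≤ w := by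
  unfold coord
  rw [le_div_iff₀ (by positivity), zero_mul, sub_nonneg]
  exact_mod_cast Iff.rfl

theorem coord_le_R {w : ℕ} : I.coord w ≤ I.R ↔ w ≤ 4 * I.len + 2 := by
  unfold coord
  rw [div_le_iff₀ (by positivity), sub_le_iff_le_add]
  have : (I.R : ℝ) * (2 * 2 ^ I.m) + (2 * I.len + 2) = ((4 * I.len + 2 : ℕ) : ℝ) := by
    push_cast; rw [len_eq]; ring
  rw [this, Nat.cast_le]

theorem coord_add_le {v w p : ℕ} : I.coord v + I.coord w ≤ 2 * (p : ℝ) ↔ v + w ≤ I.loc p := by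
  unfold coord
  rw [← add_div, div_le_iff₀ (by positivity), ← Nat.cast_le (α := ℝ)]
  simp only [loc]
  push_cast
  constructor <;> intro h <;> linarith

theorem le_coord_add {v w p : ℕ} : 2 * (p : ℝ) ≤ I.coord v + I.coord w ↔ I.loc p ≤ v + w := by
  unfold coord
  rw [← add_div, le_div_iff₀ (by positivity), ← Nat.cast_le (α := ℝ)]
  simp only [loc]
  push_cast
  constructor <;> intro h <;> linarith

theorem coord_add_eq {v w p : ℕ} : I.coord v + I.coord w = 2 * (p : ℝ) ↔ v + w = I.loc p := by
  rw [le_antisymm_iff, le_antisymm_iff, coord_add_le, le_coord_add]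

theorem loc_le {p : ℕ} (hp : p ∈ I.voters) : I.loc p ≤ 8 * I.len + 4 := by
  have : 2 ^ I.m * p ≤ 2 ^ I.m * I.R := Nat.mul_le_mul_left _ (I.le_R p hp)
  unfold loc len
  rw [mul_comm I.R]
  omega

/-- The factor 2 clears the halves in the utility. The sentinels are so far out that every voter
lies strictly on the inner side of a mean formed with one of them, as for an infinite mean. -/
theorem two_mul_util {A : Finset ℝ} {a y b : ℕ} (hA : ∀ x ∈ A, 0 ≤ x ∧ x ≤ I.R)
    (hy : 2 * I.len + 2 ≤ y) (hy' : y ≤ 4 * I.len + 2)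
    (hl : ∀ x ∈ A, x < I.coord y → x ≤ I.coord (2 * a)) (ha : a = 0 ∨ I.coord (2 * a) ∈ A)
    (hay : 2 * a < y) (hr : ∀ x ∈ A, I.coord y < x → I.coord (2 * b) ≤ x)
    (hb : b = I.last ∨ I.coord (2 * b) ∈ A) (hyb : y < 2 * b) :
    2 * I.util A (I.coord y) = I.pay a y b := by
  have h₁ : ∀ p ∈ I.voters, (leftMean A (I.coord y) ≤ ((p : ℝ) : WithBot ℝ) ↔ 2 * a + y ≤ I.loc p) ∧
      (((p : ℝ) : WithBot ℝ) = leftMean A (I.coord y) ↔ 2 * a + y = I.loc p) := by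
    intro p hp
    rw [leftMean_le_iff, eq_leftMean_iff]
    rcases ha with rfl | ha
    · have hno : ∀ x ∈ A, ¬ x < I.coord y := fun x hx hxy => by
        have h := (hA x hx).1.trans (hl x hx hxy)
        rw [coord_nonneg] at h
        omega
      have : y < I.loc p := by unfold loc; omega
      refine ⟨⟨fun _ => by omega, fun _ l hl hly => absurd hly (hno l hl)⟩, ⟨?_, fun h => by omega⟩⟩
      rintro ⟨-, l, hl, hly, -⟩
      exact absurd hly (hno l hl)
    · have hlt : I.coord (2 * a) < I.coord y := coord_strictMono hay
      have hle : (∀ l ∈ A, l < I.coord y → l + I.coord y ≤ 2 * (p : ℝ)) ↔ 2 * a + y ≤ I.loc p := by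
        rw [← coord_add_le]
        exact ⟨fun h => h _ ha hlt, fun h l hl' hly => by linarith [hl l hl' hly]⟩
      refine ⟨hle, ?_⟩
      rw [hle, ← coord_add_le, ← coord_add_eq]
      refine ⟨?_, fun h => ⟨h.le, _, ha, hlt, h⟩⟩
      rintro ⟨h, l, hl', hly, e⟩
      linarith [hl l hl' hly]
  have h₂ : ∀ p ∈ I.voters,
      (((p : ℝ) : WithTop ℝ) ≤ rightMean A (I.coord y) ↔ I.loc p ≤ y + 2 * b) ∧
      (((p : ℝ) : WithTop ℝ) = rightMean A (I.coord y) ↔ y + 2 * b = I.loc p) := by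
    intro p hp
    rw [le_rightMean_iff, eq_rightMean_iff]
    rcases hb with rfl | hb
    · have hno : ∀ x ∈ A, ¬ I.coord y < x := fun x hx hxy => by
        have h := (hr x hx hxy).trans (hA x hx).2
        rw [coord_le_R] at h
        unfold last at h
        omega
      have : I.loc p < y + 2 * I.last := by have := loc_le hp; unfold last; omega
      refine ⟨⟨fun _ => by omega, fun _ l hl hly => absurd hly (hno l hl)⟩, ⟨?_, fun h => by omega⟩⟩
      rintro ⟨-, l, hl, hly, -⟩
      exact absurd hly (hno l hl)
    · have hlt : I.coord y < I.coord (2 * b) := coord_strictMono hyb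
      have hle : (∀ l ∈ A, I.coord y < l → 2 * (p : ℝ) ≤ l + I.coord y) ↔ I.loc p ≤ y + 2 * b := by
        rw [← le_coord_add]
        exact ⟨fun h => by linarith [h _ hb hlt], fun h l hl' hly => by linarith [hr l hl' hly]⟩
      refine ⟨hle, ?_⟩
      rw [hle, ← le_coord_add, ← coord_add_eq]
      refine ⟨?_, fun h => ⟨h.ge, _, hb, hlt, by linarith⟩⟩
      rintro ⟨h, l, hl', hly, e⟩
      linarith [hr l hl' hly]
  -- Monotonicity makes the truncated subtraction in `pay` a true one.
  have hcum : I.cum (2 * a + y) ≤ I.cum (y + 2 * b) := cum_mono (by omega)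
  rw [pay, Nat.cast_sub hcum, cum, cum]
  push_cast
  rw [Instance.util]
  rw [mul_sub, mul_sub, mul_div_cancel₀ _ two_ne_zero, mul_div_cancel₀ _ two_ne_zero]
  simp only [Finset.sum_filter, Finset.mul_sum]
  rw [← Finset.sum_sub_distrib, ← Finset.sum_sub_distrib, ← Finset.sum_sub_distrib]
  refine Finset.sum_congr rfl fun p hp => ?_
  simp only [(h₁ p hp).1, (h₁ p hp).2, (h₂ p hp).1, (h₂ p hp).2]
  split_ifs <;> first | ring1 | omega

/-- The candidates sit at `z 1 < ⋯ < z m`, between the sentinels `z 0` and `z (m + 1)`. -/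
structure IsPath (I : Instance) (z : ℕ → ℕ) : Prop where
  zero : z 0 = 0
  last : z (I.m + 1) = I.last
  mem : ∀ j, 1 ≤ j → j ≤ I.m → I.len + 1 ≤ z j ∧ z j ≤ 2 * I.len + 1
  lt_succ : ∀ j ≤ I.m, z j < z (j + 1)

/-! ### Ordered profiles between the sentinels -/

namespace IsPath

variable {z : ℕ → ℕ}

theorem lt (hz : I.IsPath z) {i j : ℕ} (h : i < j) (hj : j ≤ I.m + 1) : z i < z j := by
  induction j, h using Nat.le_induction with
  | base => exact hz.lt_succ i (by omega)
  | succ j hij ih => exact (ih (by omega)).trans (hz.lt_succ j (by omega))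

theorem le (hz : I.IsPath z) {i j : ℕ} (h : i ≤ j) (hj : j ≤ I.m + 1) : z i ≤ z j := by
  rcases h.eq_or_lt with rfl | h
  exacts [le_rfl, (hz.lt h hj).le]

theorem coord_mem (hz : I.IsPath z) (i : Fin I.m) :
    0 ≤ I.coord (2 * z (i + 1)) ∧ I.coord (2 * z (i + 1)) ≤ I.R := by
  have := hz.mem (i + 1) (by omega) (by omega)
  rw [coord_nonneg, coord_le_R]
  omega

/-- Candidate `i` has index `i + 1` on the path, and `lo`, `hi` are consecutive once this index is
deleted. This covers both a foreign gap `k, k + 1` and the merged gap `i, i + 2`. -/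
theorem two_mul_util (hz : I.IsPath z) (i : Fin I.m) {lo hi y : ℕ} (hlh : lo < hi) (hhi : hi ≤ I.m + 1)
    (hlo' : lo ≠ i + 1) (hhi' : hi ≠ i + 1) (hbet : ∀ k, lo < k → k < hi → k = i + 1)
    (hy : 2 * I.len + 2 ≤ y) (hy' : y ≤ 4 * I.len + 2) (hly : 2 * z lo < y) (hyh : y < 2 * z hi) :
    2 * I.util (rivals (fun j : Fin I.m => I.coord (2 * z (j + 1))) i) (I.coord y) =
      I.pay (z lo) y (z hi) := by
  have hmem : ∀ k, k ≠ 0 → k ≤ I.m → k ≠ i + 1 →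
      I.coord (2 * z k) ∈ rivals (fun j : Fin I.m => I.coord (2 * z (j + 1))) i := by
    intro k h0 hk hki
    refine Finset.mem_image.2 ⟨⟨k - 1, by omega⟩, ?_, ?_⟩
    · simp [Fin.ext_iff]; omega
    · simp only; rw [Nat.sub_add_cancel (by omega)]
  have hriv : ∀ x ∈ rivals (fun j : Fin I.m => I.coord (2 * z (j + 1))) i,
      ∃ k, k ≠ 0 ∧ k ≤ I.m ∧ k ≠ i + 1 ∧ x = I.coord (2 * z k) := by
    intro x hx
    obtain ⟨j, hj, rfl⟩ := Finset.mem_image.1 hx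
    have : j ≠ i := by simpa using hj
    exact ⟨j + 1, by omega, by omega, by simpa [Fin.ext_iff] using this, rfl⟩
  have cases : ∀ k : ℕ, k ≠ i + 1 → k ≤ lo ∨ hi ≤ k := fun k hk => by
    by_contra h
    exact hk (hbet k (by omega) (by omega))
  refine Instance.two_mul_util (fun x hx => ?_) hy hy' (fun x hx hxy => ?_) ?_ hly
    (fun x hx hxy => ?_) ?_ hyh
  · obtain ⟨j, -, rfl⟩ := Finset.mem_image.1 hx
    exact hz.coord_mem j
  · obtain ⟨k, -, hk, hki, rfl⟩ := hriv x hx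
    refine coord_strictMono.monotone (Nat.mul_le_mul_left 2 ?_)
    rcases cases k hki with h | h
    · exact hz.le h (by omega)
    · have := coord_strictMono.lt_iff_lt.1 hxy
      have := hz.le h (by omega)
      omega
  · by_cases h : lo = 0
    · left; rw [h, hz.zero]
    · right; exact hmem lo h (by omega) hlo'
  · obtain ⟨k, -, hk, hki, rfl⟩ := hriv x hx
    refine coord_strictMono.monotone (Nat.mul_le_mul_left 2 ?_)
    rcases cases k hki with h | h
    · have := coord_strictMono.lt_iff_lt.1 hxy
      have := hz.le h (by omega)
      omega
    · exact hz.le h (by omega)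
  · by_cases h : hi = I.m + 1
    · left; rw [h, hz.last]
    · right; exact hmem hi (by omega) (by omega) hhi'

theorem two_mul_util_self (hz : I.IsPath z) (i : Fin I.m) :
    2 * I.util (rivals (fun j : Fin I.m => I.coord (2 * z (j + 1))) i) (I.coord (2 * z (i + 1))) =
      I.pay (z i) (2 * z (i + 1)) (z (i + 2)) := by
  have h₁ := hz.mem (i + 1) (by omega) (by omega)
  have h₂ := hz.lt_succ i (by omega)
  have h₃ := hz.lt_succ (i + 1) (by omega)
  exact hz.two_mul_util i (by omega) (by omega) (by omega) (by omega) (by omega) (by omega)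
    (by omega) (by omega) (by simp only [add_assoc, Nat.reduceAdd] at h₃; omega)

theorem isProfile (hz : I.IsPath z) :
    I.IsProfile (fun j : Fin I.m => I.coord (2 * z (j + 1))) := by
  refine ⟨fun i j h => ?_, hz.coord_mem⟩
  have h' : 2 * z (i + 1) = 2 * z (j + 1) := coord_strictMono.injective h
  by_contra hij
  rcases lt_or_gt_of_ne (fun e => hij (Fin.ext e) : (i : ℕ) ≠ j) with h | h
  · have := hz.lt (i := i + 1) (j := j + 1) (by omega) (by omega)
    omega
  · have := hz.lt (i := j + 1) (j := i + 1) (by omega) (by omega)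
    omega

end IsPath

/-- Every point of `[0, R]` compares with the grid points like a point of the half grid. -/
theorem exists_coord_compare (I : Instance) {y : ℝ} (hy : y ∈ Set.Icc (0 : ℝ) I.R) :
    ∃ w, 2 * I.len + 2 ≤ w ∧ w ≤ 4 * I.len + 2 ∧ ∀ g : ℤ,
      ((g : ℝ) / 2 ^ I.m < y ↔ (g : ℝ) / 2 ^ I.m < I.coord w) ∧
      (y < (g : ℝ) / 2 ^ I.m ↔ I.coord w < (g : ℝ) / 2 ^ I.m) := by
  have hD : (0 : ℝ) < 2 ^ I.m := by positivity
  set f : ℕ := ⌊y * 2 ^ I.m⌋₊ with hf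
  have hy0 : 0 ≤ y * 2 ^ I.m := mul_nonneg hy.1 hD.le
  have h₁ : (f : ℝ) ≤ y * 2 ^ I.m := Nat.floor_le hy0
  have h₂ : y * 2 ^ I.m < f + 1 := Nat.lt_floor_add_one _
  have hR : y * 2 ^ I.m ≤ I.len := by
    rw [len_eq]; exact mul_le_mul_of_nonneg_right hy.2 hD.le
  have hfl : f ≤ I.len := by exact_mod_cast h₁.trans hR
  simp only [div_lt_iff₀ hD, lt_div_iff₀ hD]
  -- A grid point represents itself; any other point is represented by the midpoint of its cell,
  -- which has an odd coordinate.
  rcases h₁.eq_or_lt with h | h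
  · refine ⟨2 * (I.len + 1 + f), by omega, by omega, fun g => ?_⟩
    have : I.coord (2 * (I.len + 1 + f)) * 2 ^ I.m = y * 2 ^ I.m := by
      rw [coord_two_mul, div_mul_cancel₀ _ hD.ne', ← h]; push_cast; ring
    rw [this]
    exact ⟨Iff.rfl, Iff.rfl⟩
  · have hlt : f < I.len := by exact_mod_cast h.trans_le hR
    refine ⟨2 * (I.len + 1 + f) + 1, by omega, by omega, fun g => ?_⟩
    have : I.coord (2 * (I.len + 1 + f) + 1) * 2 ^ I.m = f + 1 / 2 := by
      unfold coord
      push_cast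
      field_simp
      ring
    rw [this]
    rcases le_or_gt g f with hg | hg
    · have : (g : ℝ) ≤ f := by exact_mod_cast hg
      exact ⟨⟨fun _ => by linarith, fun _ => by linarith⟩,
        ⟨fun _ => by linarith, fun _ => by linarith⟩⟩
    · have : (f : ℝ) + 1 ≤ g := by exact_mod_cast hg
      exact ⟨⟨fun _ => by linarith, fun _ => by linarith⟩,
        ⟨fun _ => by linarith, fun _ => by linarith⟩⟩

/-- A deviation between her own neighbours is covered by the last clause of `Ok`; one into any other
gap earns at most `T`, which does not exceed what the candidate has. -/
theorem IsPath.isEquilibrium {z : ℕ → ℕ} (hz : I.IsPath z) {T : ℕ}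
    (hok : ∀ j < I.m, I.Ok T (z j) (z (j + 1)) (z (j + 2))) :
    I.IsEquilibrium (fun j : Fin I.m => I.coord (2 * z (j + 1))) := by
  rw [I.isEquilibrium_iff]
  refine ⟨hz.isProfile, fun i y hy hne => ?_⟩
  obtain ⟨w, hw, hw', hg⟩ := I.exists_coord_compare hy
  have hs : ∀ j : Fin I.m, I.coord (2 * z (j + 1)) =
      (((z (j + 1) : ℤ) - (I.len + 1) : ℤ) : ℝ) / 2 ^ I.m := fun j => by
    rw [coord_two_mul]; push_cast; rfl
  -- Reflections of grid points at voters are grid points, so `w` can replace `y` in the utility.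
  have hp : ∀ (j : Fin I.m) (p : ℕ), 2 * (p : ℝ) - I.coord (2 * z (j + 1)) =
      ((2 * p * 2 ^ I.m - ((z (j + 1) : ℤ) - (I.len + 1)) : ℤ) : ℝ) / 2 ^ I.m := fun j p => by
    rw [coord_two_mul]; push_cast; field_simp
  have e : I.util (rivals (fun j : Fin I.m => I.coord (2 * z (j + 1))) i) y =
      I.util (rivals (fun j : Fin I.m => I.coord (2 * z (j + 1))) i) (I.coord w) :=
    I.util_image_congr _ (fun j _ => by simp only [hs]; exact (hg _).1)
      (fun j _ => by simp only [hs]; exact (hg _).2)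
      (fun j _ p _ => by simp only [hp]; exact (hg _).1)
      (fun j _ p _ => by simp only [hp]; exact (hg _).2)
  have hwne : ∀ k, 1 ≤ k → k ≤ I.m → w = 2 * z k → k = i + 1 := by
    intro k hk hk' hwk
    by_contra hki
    refine hne ⟨k - 1, by omega⟩ (by simp [Fin.ext_iff]; omega) ?_
    have h := hg ((z k : ℤ) - (I.len + 1))
    have hc := coord_two_mul (I := I) (z k)
    simp only [Nat.sub_add_cancel hk]
    rw [hc]
    push_cast at h
    rw [hwk, hc] at h
    simp only [lt_irrefl, iff_false, not_lt] at h
    exact le_antisymm h.1 h.2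
  have hself := hz.two_mul_util_self i
  suffices h : 2 * I.util (rivals (fun j : Fin I.m => I.coord (2 * z (j + 1))) i) (I.coord w) ≤
      2 * I.util (rivals (fun j : Fin I.m => I.coord (2 * z (j + 1))) i)
        (I.coord (2 * z (i + 1))) by rw [e]; linarith
  obtain ⟨k, hk, hkw, hwk⟩ : ∃ k ≤ I.m, 2 * z k ≤ w ∧ w < 2 * z (k + 1) := by
    refine ⟨Nat.findGreatest (fun k => 2 * z k ≤ w) I.m, Nat.findGreatest_le _,
      Nat.findGreatest_spec (P := fun k => 2 * z k ≤ w) (Nat.zero_le _) (by simp [hz.zero]), ?_⟩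
    by_contra hcon
    rcases (Nat.findGreatest_le (P := fun k => 2 * z k ≤ w) I.m).eq_or_lt with h | h
    · rw [h, hz.last] at hcon
      unfold Instance.last at hcon
      omega
    · exact Nat.findGreatest_is_greatest (P := fun k => 2 * z k ≤ w) (Nat.lt_succ_self _) h
        (not_lt.1 hcon)
  have hoki := hok i i.2
  rcases hkw.eq_or_lt with heq | hlt
  · have : k ≠ 0 := by rintro rfl; rw [hz.zero] at heq; omega
    have hki := hwne k (by omega) hk heq.symm
    rw [← heq, hki]
  · rw [hself]
    have hmerge : ∀ lo hi, lo = (i : ℕ) → hi = (i : ℕ) + 2 → 2 * z lo < w → w < 2 * z hi →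
        2 * I.util (rivals (fun j : Fin I.m => I.coord (2 * z (j + 1))) i) (I.coord w) ≤
          I.pay (z i) (2 * z (i + 1)) (z (i + 2)) := by
      rintro lo hi rfl rfl h₁ h₂
      rw [hz.two_mul_util i (lo := i) (hi := i + 2) (by omega) (by omega) (by omega) (by omega)
        (by omega) hw hw' h₁ h₂]
      exact_mod_cast (hoki.2.2.2 w (by omega) hw).2.2 ⟨h₁, h₂⟩
    by_cases h₁ : k = i + 1
    · subst h₁
      have := hz.lt_succ i (by omega)
      exact hmerge i (i + 2) rfl rfl (by omega) hwk
    by_cases h₂ : k = i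
    · subst h₂
      have : z (i + 1) < z (i + 2) := hz.lt_succ (i + 1) (by omega)
      exact hmerge i (i + 2) rfl rfl hlt (by omega)
    · rw [hz.two_mul_util i (lo := k) (hi := k + 1) (by omega) (by omega) h₁ (by omega) (by omega) hw hw'
        hlt hwk]
      have hT : I.pay (z k) w (z (k + 1)) ≤ T := by
        -- The last gap is the first gap of no triple, so it is read as the second gap of the last
        -- triple.
        rcases hk.eq_or_lt with rfl | hk
        · have hm := I.one_le_m
          have := ((hok (I.m - 1) (by omega)).2.2.2 w (by omega) hw).2.1
          have e₁ : I.m - 1 + 1 = I.m := by omega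
          have e₂ : I.m - 1 + 2 = I.m + 1 := by omega
          rw [e₁, e₂] at this
          exact this ⟨hlt, hwk⟩
        · exact ((hok k hk).2.2.2 w (by omega) hw).1 ⟨hlt, hwk⟩
      exact_mod_cast hT.trans hoki.2.2.1

/-- The threshold is the smallest payoff, attained by `i₀`. Since `i₀` does not want to move, no gap
offers more than this. -/
theorem IsPath.exists_ok {z : ℕ → ℕ} (hz : I.IsPath z)
    (he : I.IsEquilibrium (fun j : Fin I.m => I.coord (2 * z (j + 1)))) :
    ∃ x₁ < 10 * I.len + 7, ∃ x₂ < 10 * I.len + 7,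
      ∀ j < I.m, I.Ok (I.cum x₂ - I.cum x₁) (z j) (z (j + 1)) (z (j + 2)) := by
  rw [I.isEquilibrium_iff] at he
  have hle : ∀ j ≤ I.m + 1, z j ≤ I.last := fun j hj => by rw [← hz.last]; exact hz.le hj le_rfl
  have dev : ∀ (i : Fin I.m) (lo hi y : ℕ), hi ≤ I.m + 1 → lo ≠ i + 1 → hi ≠ i + 1 → lo < hi →
      (∀ k, lo < k → k < hi → k = i + 1) → 2 * I.len + 2 ≤ y → y ≤ 4 * I.len + 2 →
      2 * z lo < y → y < 2 * z hi →
      I.pay (z lo) y (z hi) ≤ I.pay (z i) (2 * z (i + 1)) (z (i + 2)) := by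
    intro i lo hi y hhi hlo' hhi' hlh hbet hy hy' hly hyh
    have h := he.2 i (I.coord y) ⟨coord_nonneg.2 hy, coord_le_R.2 hy'⟩ (fun j hj e => by
      have e' := coord_strictMono.injective e
      have hj' : (j : ℕ) ≠ i := fun h => hj (Fin.ext h)
      rcases Nat.lt_or_ge lo (j + 1) with h | h
      · rcases Nat.lt_or_ge (j + 1) hi with h' | h'
        · have := hbet _ h h'; omega
        · have := hz.le h' (by omega); omega
      · have := hz.le h (by omega); omega)
    have h₁ := hz.two_mul_util i hlh hhi hlo' hhi' hbet hy hy' hly hyh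
    have h₂ := hz.two_mul_util_self i
    have : (I.pay (z lo) y (z hi) : ℝ) ≤ I.pay (z i) (2 * z (i + 1)) (z (i + 2)) := by
      rw [← h₁, ← h₂]; linarith
    exact_mod_cast this
  have : Nonempty (Fin I.m) := ⟨⟨0, I.one_le_m⟩⟩
  obtain ⟨i₀, -, hi₀⟩ := Finset.exists_min_image Finset.univ
    (fun i : Fin I.m => I.pay (z i) (2 * z (i + 1)) (z (i + 2))) Finset.univ_nonempty
  have b₁ := hz.mem (i₀ + 1) (by omega) (by omega)
  have b₀ : z i₀ < z (i₀ + 1) := hz.lt_succ i₀ (by omega)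
  have b₂ := hle (i₀ + 2) (by omega)
  have hl : I.last = 3 * I.len + 2 := rfl
  -- The larger argument is at most `2 * (2 * len + 1) + 2 * (3 * len + 2) = 10 * len + 6`.
  refine ⟨2 * z i₀ + 2 * z (i₀ + 1), by omega, 2 * z (i₀ + 1) + 2 * z (i₀ + 2), by omega,
    fun j hj => ?_⟩
  change I.Ok (I.pay (z i₀) (2 * z (i₀ + 1)) (z (i₀ + 2))) _ _ _
  have gap : ∀ k y, k ≤ I.m → 2 * I.len + 2 ≤ y → y ≤ 4 * I.len + 2 → 2 * z k < y →
      y < 2 * z (k + 1) →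
      I.pay (z k) y (z (k + 1)) ≤ I.pay (z i₀) (2 * z (i₀ + 1)) (z (i₀ + 2)) := by
    intro k y hk hy hy' h₁ h₂
    -- For the two gaps next to `i₀`, deleting `i₀` merges them, which can only raise the payoff at
    -- `y`; the merged payoff is bounded by that of `i₀`.
    by_cases hk₁ : k = i₀ + 1
    · subst hk₁
      have := hz.lt_succ i₀ (by omega)
      refine le_trans (Nat.sub_le_sub_left (cum_mono (by omega)) _)
        (dev i₀ i₀ (i₀ + 2) y (by omega) (by omega) (by omega) (by omega) (by omega) hy hy'
          (by omega) h₂)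
    by_cases hk₂ : k = i₀
    · subst hk₂
      have : z (i₀ + 1) < z (i₀ + 2) := hz.lt_succ (i₀ + 1) (by omega)
      refine le_trans (Nat.sub_le_sub_right (cum_mono (by omega)) _)
        (dev i₀ i₀ (i₀ + 2) y (by omega) (by omega) (by omega) (by omega) (by omega) hy hy'
          h₁ (by omega))
    · exact dev i₀ k (k + 1) y (by omega) hk₁ (by omega) (by omega) (by omega) hy hy' h₁ h₂
  refine ⟨hz.lt_succ j hj.le, hz.lt_succ (j + 1) hj, hi₀ ⟨j, hj⟩ (Finset.mem_univ _), ?_⟩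
  refine fun y hy' hy => ⟨fun h => gap j y hj.le hy (by omega) h.1 h.2,
    fun h => gap (j + 1) y hj hy (by omega) h.1 h.2, fun h => ?_⟩
  exact dev ⟨j, hj⟩ j (j + 2) y (by omega) (by simp) (by simp) (by omega)
    (by intros; simp only; omega) hy (by omega) h.1 h.2

theorem IsEquilibrium.comp_perm {s : Fin I.m → ℝ} (hs : I.IsEquilibrium s)
    (e : Equiv.Perm (Fin I.m)) : I.IsEquilibrium (fun i => s (e i)) := by
  rw [I.isEquilibrium_iff] at hs ⊢
  have hr : ∀ i, rivals (fun i => s (e i)) i = rivals s (e i) := by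
    intro i
    ext x
    simp only [rivals, Finset.mem_image, Finset.mem_erase, Finset.mem_univ, and_true]
    constructor
    · rintro ⟨j, hj, rfl⟩
      exact ⟨e j, by simpa using hj, rfl⟩
    · rintro ⟨j, hj, rfl⟩
      exact ⟨e.symm j, by rintro rfl; simp at hj, by simp⟩
  refine ⟨⟨hs.1.1.comp e.injective, fun i => hs.1.2 (e i)⟩, fun i y hy hne => ?_⟩
  rw [hr]
  refine hs.2 (e i) y hy fun j hj => ?_
  have := hne (e.symm j) (by rintro rfl; simp at hj)
  simpa using this

/-- Candidates are interchangeable, so a grid equilibrium may be sorted; the grid index `q` becomes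
the slot `q + len + 1`. -/
theorem exists_path (h : ∃ s, I.IsEquilibrium s) :
    ∃ z, I.IsPath z ∧ I.IsEquilibrium (fun j : Fin I.m => I.coord (2 * z (j + 1))) := by
  obtain ⟨s, hs⟩ := h
  obtain ⟨g, hg⟩ := hs.exists_grid
  have hsort := Tuple.monotone_sort g
  have hq := hg.comp_perm (Tuple.sort g)
  set q : Fin I.m → ℕ := g ∘ Tuple.sort g with hqdef
  have hD : (0 : ℝ) < 2 ^ I.m := by positivity
  have hqle : ∀ i, q i ≤ I.len := fun i => by
    have := (hq.1.2 i).2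
    rw [div_le_iff₀ hD, ← len_eq] at this
    exact_mod_cast this
  have hstrict : StrictMono q := hsort.strictMono_of_injective fun i j hij =>
    hq.1.1 (by simp only [hqdef, Function.comp_apply] at hij; simp only [hij])
  have key : ∀ i : Fin I.m, I.coord (2 * (q i + I.len + 1)) = (q i : ℝ) / 2 ^ I.m := fun i => by
    rw [coord_two_mul]; push_cast; congr 1; ring
  refine ⟨fun j => if j = 0 then 0 else if h : j - 1 < I.m then q ⟨j - 1, h⟩ + I.len + 1 else I.last,
    ⟨by simp, by simp, fun j h₁ h₂ => ?_, fun j hj => ?_⟩, ?_⟩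
  · have h0 : j ≠ 0 := by omega
    have hm : j - 1 < I.m := by omega
    simp only [h0, hm, if_false, dif_pos]
    have := hqle ⟨j - 1, hm⟩
    omega
  · by_cases h0 : j = 0
    · subst h0
      have hm : 0 < I.m := I.one_le_m
      simp [hm]
    · have hm : j - 1 < I.m := by omega
      by_cases hm' : j < I.m
      · have := hstrict (show (⟨j - 1, hm⟩ : Fin I.m) < ⟨j, hm'⟩ from by simp [Fin.lt_def]; omega)
        simp only [h0, hm, if_false, dif_pos, Nat.add_sub_cancel, hm', Nat.succ_ne_zero]
        omega
      · have := hqle ⟨j - 1, hm⟩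
        simp only [h0, hm, if_false, dif_pos, Nat.add_sub_cancel, hm', Nat.succ_ne_zero, last,
          dif_neg, not_false_eq_true]
        omega
  · convert hq using 2 with i
    refine Eq.trans ?_ (key i)
    simp

/-! #### The table -/

/-- The table of the dynamic program: `val T i a b` is nonzero if `a, b` can be continued by `i`
further slots, the last one being the right sentinel, with all triples satisfying `Ok T`; the
next slot is then `val T i a b - 1`. -/
noncomputable def val (I : Instance) (T : ℕ) : ℕ → ℕ → ℕ → ℕ
  | 0, _, b => if b = I.last then 1 else 0
  | i + 1, a, b => pick (I.last + 1) fun c => (I.Slot c ∧ I.Ok T a b c) ∧ 1 ≤ val I T i b c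

/-- The path that starts with the slot `b` and follows the table. -/
noncomputable def path (I : Instance) (T b : ℕ) : ℕ → ℕ
  | 0 => 0
  | 1 => b
  | j + 2 => I.val T (I.m - j) (path I T b j) (path I T b (j + 1)) - 1

theorem Slot.le_last {c : ℕ} (h : I.Slot c) : c ≤ I.last := by
  rcases h with h | h
  · unfold last; omega
  · exact h.le

theorem IsPath.slot {z : ℕ → ℕ} (hz : I.IsPath z) {j : ℕ} (h₁ : 1 ≤ j) (h₂ : j ≤ I.m + 1) :
    I.Slot (z j) := by
  rcases h₂.eq_or_lt with rfl | h
  · exact .inr hz.last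
  · exact .inl (hz.mem j h₁ (by omega))

theorem IsPath.one_le_val {z : ℕ → ℕ} (hz : I.IsPath z) {T : ℕ}
    (hok : ∀ j < I.m, I.Ok T (z j) (z (j + 1)) (z (j + 2))) (q j : ℕ) (h : j + q = I.m) :
    1 ≤ I.val T q (z j) (z (j + 1)) := by
  induction q generalizing j with
  | zero =>
    obtain rfl : j = I.m := by omega
    simp [val, hz.last]
  | succ q ih =>
    have hs := hz.slot (j := j + 2) (by omega) (by omega)
    rw [val, one_le_pick_iff]
    exact ⟨z (j + 2), by have := hs.le_last; omega, ⟨hs, hok j (by omega)⟩, ih (j + 1) (by omega)⟩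

/-- A nonzero entry names a next slot whose own entry is again nonzero, so following the table never
gets stuck; in layer 0 a nonzero entry forces the right sentinel. -/
theorem path_spec {T b : ℕ} (hb : I.Slot b) (h : 1 ≤ I.val T I.m 0 b) :
    I.IsPath (I.path T b) ∧
      ∀ j < I.m, I.Ok T (I.path T b j) (I.path T b (j + 1)) (I.path T b (j + 2)) := by
  have step : ∀ j < I.m, 1 ≤ I.val T (I.m - j) (I.path T b j) (I.path T b (j + 1)) →
      (I.Slot (I.path T b (j + 2)) ∧ I.Ok T (I.path T b j) (I.path T b (j + 1)) (I.path T b (j + 2))) ∧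
        1 ≤ I.val T (I.m - (j + 1)) (I.path T b (j + 1)) (I.path T b (j + 2)) := by
    intro j hj hv
    obtain ⟨q, hq⟩ : ∃ q, I.m - j = q + 1 := ⟨I.m - j - 1, by omega⟩
    have hq' : I.m - (j + 1) = q := by omega
    have e : I.path T b (j + 2) = I.val T (q + 1) (I.path T b j) (I.path T b (j + 1)) - 1 := by
      rw [path, hq]
    rw [hq, val] at hv
    rw [hq', e, val]
    exact (pick_sub_one_spec hv).2
  have hval : ∀ j ≤ I.m, 1 ≤ I.val T (I.m - j) (I.path T b j) (I.path T b (j + 1)) := by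
    intro j
    induction j with
    | zero => intro _; simpa [path] using h
    | succ j ih => exact fun hj => (step j (by omega) (ih (by omega))).2
  have hok := fun j (hj : j < I.m) => (step j hj (hval j hj.le)).1.2
  have hlast : I.path T b (I.m + 1) = I.last := by
    have := hval I.m le_rfl
    rw [Nat.sub_self, val] at this
    by_contra hne
    simp [hne] at this
  have hslot : ∀ j ≤ I.m, I.Slot (I.path T b (j + 1)) := by
    rintro (_ | j) hj
    · simpa [path] using hb
    · exact (step j (by omega) (hval j (by omega))).1.1
  have hlt : ∀ j ≤ I.m, I.path T b j < I.path T b (j + 1) := by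
    rintro (_ | j) hj
    · exact (hok 0 I.one_le_m).1
    · exact (hok j (by omega)).2.1
  refine ⟨⟨by simp [path], hlast, fun j h₁ h₂ => ?_, hlt⟩, hok⟩
  obtain ⟨j, rfl⟩ : ∃ k, j = k + 1 := ⟨j - 1, by omega⟩
  rcases hslot j (by omega) with h' | h'
  · exact h'
  -- An earlier slot cannot be the sentinel, since a strictly larger slot follows and none exceeds
  -- `last`.
  · have h₃ := hlt (j + 1) (by omega)
    have h₄ : I.path T b (j + 1 + 1) ≤ I.last := by
      rcases h₂.eq_or_lt with h₅ | h₅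
      · rw [h₅, hlast]
      · exact (hslot (j + 1) (by omega)).le_last
    omega

/-- The parameters `x₁, x₂` of the threshold and the first slot `b` lead to an equilibrium. -/
def Solution (I : Instance) (x₁ x₂ b : ℕ) : Prop :=
  I.Slot b ∧ 1 ≤ I.val (I.cum x₂ - I.cum x₁) I.m 0 b

theorem Solution.isEquilibrium {x₁ x₂ b : ℕ} (h : I.Solution x₁ x₂ b) :
    I.IsEquilibrium (fun i : Fin I.m =>
      ((I.path (I.cum x₂ - I.cum x₁) b (i + 1) - (I.len + 1) : ℕ) : ℝ) / 2 ^ I.m) := by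
  obtain ⟨hz, hok⟩ := path_spec h.1 h.2
  convert hz.isEquilibrium hok using 2 with i
  rw [coord_two_mul, Nat.cast_sub (hz.mem (i + 1) (by omega) (by omega)).1]
  push_cast
  rfl

theorem exists_solution (h : ∃ s, I.IsEquilibrium s) :
    ∃ x₁ < 10 * I.len + 7, ∃ x₂ < 10 * I.len + 7, ∃ b < 10 * I.len + 7, I.Solution x₁ x₂ b := by
  obtain ⟨z, hz, he⟩ := exists_path h
  obtain ⟨x₁, h₁, x₂, h₂, hok⟩ := hz.exists_ok he
  have hs := hz.slot (j := 1) le_rfl (by omega)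
  refine ⟨x₁, h₁, x₂, h₂, z 1, by have := hs.le_last; unfold last at this; omega, hs, ?_⟩
  have := hz.one_le_val hok I.m 0 (by omega)
  rwa [hz.zero] at this

end Instance

end Hotelling

/-! ### The program -/

namespace Hotelling

variable {X : Ctx} {a d : ℕ}

/-- A register of the context holds `e`. -/
def HasReg (X : Ctx) (e : X.Γ → ℕ) : Prop := ∃ x < X.b, ∀ γ ρ, X.regs γ ρ → ρ x = e γ

theorem HasReg.pop {e : X.Γ → ℕ} (h : HasReg X e) {r : ℕ} {hr : X.b ≤ r}
    {D : X.Γ → ℕ → Prop} : HasReg (X.push r hr D) (fun g => e g.1) := by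
  obtain ⟨x, hx, h⟩ := h
  exact ⟨x, by simp only; omega, fun g ρ hg => h g.1 ρ hg.1⟩

theorem HasReg.top {r : ℕ} {hr : X.b ≤ r} {D : X.Γ → ℕ → Prop} :
    HasReg (X.push r hr D) (fun g => g.2) :=
  ⟨r, Nat.lt_succ_self r, fun _ _ hg => hg.2.1⟩

theorem HasReg.restrict {e : X.Γ → ℕ} (h : HasReg X e) {p : X.Γ → Prop} :
    HasReg (X.restrict p) e := by
  obtain ⟨x, hx, h⟩ := h
  exact ⟨x, hx, fun g ρ hg => h g ρ hg.1⟩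

theorem HasReg.setMem {e : X.Γ → ℕ} (h : HasReg X e) {J : X.Γ → (ℕ → ℕ) → Prop} :
    HasReg (X.setMem J) e := h

theorem HasReg.computes {e : X.Γ → ℕ} (h : HasReg X e) : Computes X e a := by
  obtain ⟨x, hx, h⟩ := h
  exact .expr (.reg x) fun γ σ hγ _ => h γ _ hγ

/-- The context knows the parameters of the instance `inst γ`. -/
structure Ctx.Over (X : Ctx) (inst : X.Γ → Instance) : Prop where
  size : ∀ γ, X.size γ = (inst γ).size
  m : HasReg X fun γ => (inst γ).m
  card : HasReg X fun γ => (inst γ).voters.card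
  pow : HasReg X fun γ => 2 ^ (inst γ).m
  len : HasReg X fun γ => (inst γ).len

theorem Ctx.Over.pop {inst : X.Γ → Instance} (h : X.Over inst) {r : ℕ} {hr : X.b ≤ r}
    {D : X.Γ → ℕ → Prop} : (X.push r hr D).Over (fun g => inst g.1) :=
  ⟨fun g => h.size g.1, h.m.pop, h.card.pop, h.pow.pop, h.len.pop⟩

theorem Ctx.Over.restrict {inst : X.Γ → Instance} (h : X.Over inst) {p : X.Γ → Prop} :
    (X.restrict p).Over inst :=
  ⟨h.size, h.m.restrict, h.card.restrict, h.pow.restrict, h.len.restrict⟩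

theorem Ctx.Over.setMem {inst : X.Γ → Instance} (h : X.Over inst) {J : X.Γ → (ℕ → ℕ) → Prop} :
    (X.setMem J).Over inst :=
  ⟨h.size, h.m, h.card, h.pow, h.len⟩

/-! ### Size bounds and the layout of the table in memory -/

namespace Instance

/-- The memory holds the input. -/
def Holds (I : Instance) (M : ℕ → ℕ) : Prop := ∀ a < 2 * I.voters.card, M a = I.cells.getD a 0

theorem len_le_size (I : Instance) : I.len ≤ I.size := by
  unfold len size
  rw [pow_add]
  exact Nat.mul_le_mul_right _ (Nat.le_pow_clog (by norm_num) _)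

theorem two_pow_le_len (I : Instance) : 2 ^ I.m ≤ I.len :=
  Nat.le_mul_of_pos_left _ I.one_le_R

theorem m_lt_len (I : Instance) : I.m < I.len :=
  (Nat.lt_two_pow_self (n := I.m)).trans_le I.two_pow_le_len

theorem R_le_len (I : Instance) : I.R ≤ I.len := Nat.le_mul_of_pos_right _ (by positivity)

theorem one_le_size (I : Instance) : 1 ≤ I.size := Nat.one_le_two_pow

theorem card_voters_le (I : Instance) : I.voters.card ≤ I.R + 1 := by
  have : I.voters ⊆ Finset.range (I.R + 1) := fun p hp => by
    have := I.le_R p hp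
    simp; omega
  simpa using Finset.card_le_card this

/-- The radix of the addresses of the table. -/
def radix (I : Instance) : ℕ := 10 * I.len + 7

theorem radix_le (I : Instance) : I.radix ≤ 17 * I.size ^ 1 := by
  have := I.len_le_size
  have := I.one_le_size
  rw [pow_one]
  unfold radix
  omega

theorem two_card_lt_radix (I : Instance) : 2 * I.voters.card < I.radix := by
  have := I.card_voters_le
  have := I.R_le_len
  unfold radix
  omega

/-- Turns a sum over the set of voters into a loop over memory cells: cell `i` holds a position and
cell `card + i` its weight. -/
theorem sum_voters (I : Instance) (f : ℕ → ℕ → ℕ) :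
    ∑ p ∈ I.voters, f p (I.F p) = ∑ i ∈ Finset.range I.voters.card,
      f (I.cells.getD i 0) (I.cells.getD (I.voters.card + i) 0) := by
  have key : ∀ (l : List ℕ) (h : ℕ → ℕ),
      ∑ i ∈ Finset.range l.length, h (l.getD i 0) = (l.map h).sum := by
    intro l h
    induction l with
    | nil => simp
    | cons x l ih => simp [Finset.sum_range_succ', ← ih, add_comm]
  have hlen : (I.voters.sort (· ≤ ·)).length = I.voters.card := Finset.length_sort _
  have e : ∑ p ∈ I.voters, f p (I.F p) =
      ((I.voters.sort (· ≤ ·)).map fun p => f p (I.F p)).sum := by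
    rw [← List.sum_toFinset _ (Finset.sort_nodup _ _), Finset.sort_toFinset]
  rw [e, ← key, hlen]
  refine Finset.sum_congr rfl fun i hi => ?_
  have hi' : i < (I.voters.sort (· ≤ ·)).length := by rw [hlen]; simpa using hi
  have h₁ : I.cells.getD i 0 = (I.voters.sort (· ≤ ·)).getD i 0 := List.getD_append _ _ _ _ hi'
  have h₂ : I.cells.getD (I.voters.card + i) 0 = I.F ((I.voters.sort (· ≤ ·)).getD i 0) := by
    rw [cells, List.getD_append_right _ _ _ _ (by omega), hlen, Nat.add_sub_cancel_left,
      List.getD_eq_getElem _ _ (by simpa using hi), List.getD_eq_getElem _ _ hi', List.getElem_map]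
  rw [h₁, h₂]

/-- The address of an entry of the table. -/
def addr (I : Instance) (i x₁ x₂ a b : ℕ) : ℕ :=
  I.radix * (I.radix * (I.radix * (I.radix * (i + 1) + x₁) + x₂) + a) + b

/-- The value of an entry of the table. -/
noncomputable def entry (I : Instance) (i x₁ x₂ a b : ℕ) : ℕ :=
  I.val (I.cum x₂ - I.cum x₁) i a b

/-- The leading digit of an address is `i + 1`, never 0, so the table lies above the input, which
fills fewer than `radix` cells. -/
theorem radix_le_addr (I : Instance) (i x₁ x₂ a b : ℕ) : I.radix ≤ I.addr i x₁ x₂ a b := by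
  have h : 1 ≤ I.radix := by unfold radix; omega
  unfold addr
  refine (Nat.le_mul_of_pos_right _ ?_).trans (Nat.le_add_right _ _)
  positivity

theorem mul_add_lt {K q q' r r' : ℕ} (h : q < q') (hr : r < K) : K * q + r < K * q' + r' := by
  have : K * (q + 1) ≤ K * q' := Nat.mul_le_mul_left K h
  rw [Nat.mul_succ] at this
  omega

theorem mul_add_inj {K q q' r r' : ℕ} (hr : r < K) (hr' : r' < K)
    (h : K * q + r = K * q' + r') : q = q' ∧ r = r' := by
  rcases lt_trichotomy q q' with hq | rfl | hq
  · have := mul_add_lt (r' := r') hq hr; omega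
  · exact ⟨rfl, by omega⟩
  · have := mul_add_lt (r' := r) hq hr'; omega

theorem addr_lt {I : Instance} {i x₁ x₂ a b i' x₁' x₂' a' b' : ℕ} (h : i < i')
    (h₁ : x₁ < I.radix) (h₂ : x₂ < I.radix) (ha : a < I.radix) (hb : b < I.radix) :
    I.addr i x₁ x₂ a b < I.addr i' x₁' x₂' a' b' :=
  mul_add_lt (mul_add_lt (mul_add_lt (mul_add_lt (by omega) h₁) h₂) ha) hb

/-- The memory holds the input and the table up to the address `q`. -/
def Filled (I : Instance) (q : ℕ) (M : ℕ → ℕ) : Prop :=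
  I.Holds M ∧ ∀ i x₁ x₂ a b, x₁ < I.radix → x₂ < I.radix → a < I.radix → b < I.radix →
    I.addr i x₁ x₂ a b < q → M (I.addr i x₁ x₂ a b) = I.entry i x₁ x₂ a b

theorem Holds.update {I : Instance} {M : ℕ → ℕ} (h : I.Holds M) {q v : ℕ} (hq : I.radix ≤ q) :
    I.Holds (Function.update M q v) := fun x hx => by
  have := I.two_card_lt_radix
  rw [Function.update_of_ne (by omega), h x hx]

/-- Digits in base `radix` are unique, so the written cell belongs to exactly one entry. -/
theorem Filled.update {I : Instance} {i x₁ x₂ a b : ℕ} {M : ℕ → ℕ}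
    (h : I.Filled (I.addr i x₁ x₂ a b) M) (h₁ : x₁ < I.radix) (h₂ : x₂ < I.radix)
    (ha : a < I.radix) (hb : b < I.radix) :
    I.Filled (I.addr i x₁ x₂ a (b + 1))
      (Function.update M (I.addr i x₁ x₂ a b) (I.entry i x₁ x₂ a b)) := by
  refine ⟨h.1.update (I.radix_le_addr _ _ _ _ _), fun i' x₁' x₂' a' b' k₁ k₂ ka kb hlt => ?_⟩
  by_cases heq : I.addr i' x₁' x₂' a' b' = I.addr i x₁ x₂ a b
  · rw [heq, Function.update_self]
    obtain ⟨e₁, rfl⟩ := mul_add_inj kb hb heq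
    obtain ⟨e₂, rfl⟩ := mul_add_inj ka ha e₁
    obtain ⟨e₃, rfl⟩ := mul_add_inj k₂ h₂ e₂
    obtain ⟨e₄, rfl⟩ := mul_add_inj k₁ h₁ e₃
    obtain rfl : i' = i := by omega
    rfl
  · rw [Function.update_of_ne heq]
    refine h.2 i' x₁' x₂' a' b' k₁ k₂ ka kb ?_
    have : I.addr i x₁ x₂ a (b + 1) = I.addr i x₁ x₂ a b + 1 := rfl
    omega

end Instance

/-! ### Programs for payoffs, local conditions and the table -/

section computes

variable {inst : X.Γ → Instance}

theorem Ctx.Over.computes_last (h : X.Over inst) : Computes X (fun γ => (inst γ).last) a :=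
  ((h.len.computes.add h.len.computes).add (h.len.computes.add (.const 2))).congr
    fun γ _ _ _ _ => by unfold Instance.last; ring

theorem Ctx.Over.computes_radix (h : X.Over inst) : Computes X (fun γ => (inst γ).radix) a := by
  have h₁ : Computes X (fun γ => (inst γ).len) a := h.len.computes
  have h₂ := h₁.add h₁
  exact ((((h₂.add h₂).add h₂).add (h₂.add h₂)).add (.const 7)).congr
    fun γ _ _ _ _ => by unfold Instance.radix; ring

theorem Ctx.Over.radix_le (h : X.Over inst) (γ : X.Γ) : (inst γ).radix ≤ 17 * X.size γ ^ 1 := by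
  rw [h.size]; exact (inst γ).radix_le

theorem Ctx.Over.decides_slot (h : X.Over inst) {e : X.Γ → ℕ} (he : Computes X e a) :
    Decides X (fun γ => (inst γ).Slot (e γ)) a :=
  ((Decides.le (h.len.computes.add (.const 1)) he).and
    (Decides.le he ((h.len.computes.add h.len.computes).add (.const 1))).restrict).or
      (Decides.eq he h.computes_last) |>.congr fun γ _ _ _ _ => by
        unfold Instance.Slot; rw [two_mul]

theorem Ctx.Over.computes_loc (h : X.Over inst) {e : X.Γ → ℕ} (he : Computes X e 1) :
    Computes X (fun γ => (inst γ).loc (e γ)) 1 := by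
  -- Adding `e γ` exactly `2 ^ m` times stays linear in the size, however large `e γ` is.
  have h₁ : Computes X (fun γ => 2 ^ (inst γ).m * e γ) 1 :=
    Computes.mul (C := 1) (a := 0) (d := 1) h.pow.computes he fun γ _ _ => by
      rw [h.size, one_mul, pow_one]
      exact (inst γ).two_pow_le_len.trans (inst γ).len_le_size
  have h₂ := (h.len.computes.add (.const 1)).add h₁
  have h₃ := h₂.add h₂
  exact (h₃.add h₃).congr fun γ _ _ _ _ => by unfold Instance.loc; ring

/-- One factor of the size is for the loop over the voters, one for the multiplication in `loc`.
Strict comparisons appear as `≤` with exchanged branches, since the machine tests only `≤`. -/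
theorem Ctx.Over.computes_cum (h : X.Over inst) (hM : ∀ γ M, X.mem γ M → (inst γ).Holds M)
    {e : X.Γ → ℕ} (he : Computes X e 2) : Computes X (fun γ => (inst γ).cum (e γ)) 2 := by
  refine (Computes.bind (f := fun g => ∑ i ∈ Finset.range (inst g.1).voters.card,
    ((if g.2 ≤ (inst g.1).loc ((inst g.1).cells.getD i 0) then 0
        else (inst g.1).cells.getD ((inst g.1).voters.card + i) 0) +
      if (inst g.1).loc ((inst g.1).cells.getD i 0) ≤ g.2 then
        (inst g.1).cells.getD ((inst g.1).voters.card + i) 0 else 0)) he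
    fun r hr => ?_).congr fun γ _ _ _ _ => ?_
  · refine Computes.sum (a := 1) (d := 1) (C := 2) (f := fun g : (X.Γ × ℕ) × ℕ =>
      ((if g.1.2 ≤ (inst g.1.1).loc ((inst g.1.1).cells.getD g.2 0) then 0
        else (inst g.1.1).cells.getD ((inst g.1.1).voters.card + g.2) 0) +
      if (inst g.1.1).loc ((inst g.1.1).cells.getD g.2 0) ≤ g.1.2 then
        (inst g.1.1).cells.getD ((inst g.1.1).voters.card + g.2) 0 else 0))
      h.pop.card.computes (fun g _ _ => ?_) fun r' hr' => ?_
    · have := (inst g.1).card_voters_le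
      have := (inst g.1).R_le_len
      have := (inst g.1).len_le_size
      have := (inst g.1).one_le_size
      simp only [h.size, pow_one]
      omega
    · have o := (h.pop (r := r) (hr := hr) (D := fun γ x => x = e γ)).pop (r := r') (hr := hr')
        (D := fun g i => i < (inst g.1).voters.card)
      have hv := o.computes_loc (Computes.load (v := fun g : (X.Γ × ℕ) × ℕ => (inst g.1.1).cells.getD g.2 0)
        HasReg.top.computes fun g ρ M hg hm => hM _ _ hm _ (by have := hg.2.2; simp only at this; omega))
      have hw := Computes.load (v := fun g : (X.Γ × ℕ) × ℕ =>
          (inst g.1.1).cells.getD ((inst g.1.1).voters.card + g.2) 0)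
        (o.card.computes.add (HasReg.top.computes (a := 1)))
        fun g ρ M hg hm => hM _ _ hm _ (by have := hg.2.2; simp only at this ⊢; omega)
      exact (Computes.iteLE HasReg.top.pop.computes hv (.const 0) hw.restrict).add
        (Computes.iteLE hv HasReg.top.pop.computes hw.restrict (.const 0))
  · simp only [Instance.cum]
    rw [(inst γ).sum_voters fun p f => (if (inst γ).loc p < e γ then f else 0) +
      if (inst γ).loc p ≤ e γ then f else 0]
    refine Finset.sum_congr rfl fun i _ => ?_
    congr 1
    simp only [← not_le, ite_not]

theorem Ctx.Over.computes_pay (h : X.Over inst) (hM : ∀ γ M, X.mem γ M → (inst γ).Holds M)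
    {e f g : X.Γ → ℕ} (he : Computes X e 2) (hf : Computes X f 2) (hg : Computes X g 2) :
    Computes X (fun γ => (inst γ).pay (e γ) (f γ) (g γ)) 2 :=
  ((h.computes_cum hM (hf.add (hg.add hg))).sub
    (h.computes_cum hM ((he.add he).add hf))).congr fun γ _ _ _ _ => by
      unfold Instance.pay; rw [two_mul, two_mul]

theorem Ctx.Over.decides_ok (h : X.Over inst) (hM : ∀ γ M, X.mem γ M → (inst γ).Holds M)
    {T e f g : X.Γ → ℕ} (hT : Computes X T 2) (he : Computes X e 2) (hf : Computes X f 2)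
    (hg : Computes X g 2) : Decides X (fun γ => (inst γ).Ok (T γ) (e γ) (f γ) (g γ)) 3 := by
  have two {Y : Ctx} {v : Y.Γ → ℕ} (hv : Computes Y v 2) : Computes Y (fun γ => 2 * v γ) 2 :=
    (hv.add hv).congr fun _ _ _ _ _ => (two_mul _).symm
  have hall : Decides X (fun γ => ∀ y < 4 * (inst γ).len + 3, 2 * (inst γ).len + 2 ≤ y →
    (2 * e γ < y ∧ y < 2 * f γ → (inst γ).pay (e γ) y (f γ) ≤ T γ) ∧
    (2 * f γ < y ∧ y < 2 * g γ → (inst γ).pay (f γ) y (g γ) ≤ T γ) ∧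
    (2 * e γ < y ∧ y < 2 * g γ → (inst γ).pay (e γ) y (g γ) ≤
      (inst γ).pay (e γ) (2 * f γ) (g γ))) 3 := by
    refine Decides.forall_lt (a := 2) (d := 1) (C := 7) (B := fun γ => 4 * (inst γ).len + 3)
      (p := fun q => 2 * (inst q.1).len + 2 ≤ q.2 →
      (2 * e q.1 < q.2 ∧ q.2 < 2 * f q.1 → (inst q.1).pay (e q.1) q.2 (f q.1) ≤ T q.1) ∧
      (2 * f q.1 < q.2 ∧ q.2 < 2 * g q.1 → (inst q.1).pay (f q.1) q.2 (g q.1) ≤ T q.1) ∧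
      (2 * e q.1 < q.2 ∧ q.2 < 2 * g q.1 → (inst q.1).pay (e q.1) q.2 (g q.1) ≤
        (inst q.1).pay (e q.1) (2 * f q.1) (g q.1))) ?_ (fun γ _ _ => ?_) fun r hr => ?_
    · exact (((two h.len.computes).add (two h.len.computes)).mono (by norm_num)).add (.const 3)
        |>.congr fun γ _ _ _ _ => by ring
    · have := (inst γ).len_le_size
      have := (inst γ).one_le_size
      rw [h.size, pow_one]
      omega
    · have o := h.pop (r := r) (hr := hr) (D := fun γ i => i < 4 * (inst γ).len + 3)
      have hy : Computes (X.push r hr fun γ i => i < 4 * (inst γ).len + 3) (fun q => q.2) 2 :=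
        Computes.top
      have he' := he.pop (r := r) (hr := hr) (D := fun γ i => i < 4 * (inst γ).len + 3)
      have hf' := hf.pop (r := r) (hr := hr) (D := fun γ i => i < 4 * (inst γ).len + 3)
      have hg' := hg.pop (r := r) (hr := hr) (D := fun γ i => i < 4 * (inst γ).len + 3)
      have hT' := hT.pop (r := r) (hr := hr) (D := fun γ i => i < 4 * (inst γ).len + 3)
      have hM' : ∀ (γ : X.Γ × ℕ) M, X.mem γ.1 M → (inst γ.1).Holds M := fun γ M h => hM _ _ h
      have bet {u v w : X.Γ × ℕ → ℕ}
          (hu : Computes (X.push r hr fun γ i => i < 4 * (inst γ).len + 3) u 2)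
          (hv : Computes (X.push r hr fun γ i => i < 4 * (inst γ).len + 3) v 2)
          (hw : Computes (X.push r hr fun γ i => i < 4 * (inst γ).len + 3) w 2) :
          Decides (X.push r hr fun γ i => i < 4 * (inst γ).len + 3) (fun q =>
            2 * u q < q.2 ∧ q.2 < 2 * v q → (inst q.1).pay (u q) q.2 (v q) ≤ w q) 2 :=
        ((Decides.lt (two hu) hy).and (Decides.lt hy (two hv)).restrict).imp
          (Decides.le (o.computes_pay hM' hu hy hv) hw).restrict
      exact (Decides.le ((two o.len.computes).add (.const 2)) hy).imp ((bet he' hf' hT').and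
        ((bet hf' hg' hT').and (bet he' hg'
          (o.computes_pay hM' he' (two hf') hg')).restrict).restrict).restrict
  exact ((Decides.lt he hf).mono (by norm_num)).and (((Decides.lt hf hg).mono (by norm_num)).and
    (((Decides.le hT (h.computes_pay hM he (two hf) hg)).mono (by norm_num)).and
      hall.restrict).restrict).restrict

theorem Ctx.Over.computes_addr (h : X.Over inst) {i x₁ x₂ e f : X.Γ → ℕ}
    (hi : Computes X i 1) (h₁ : Computes X x₁ 1) (h₂ : Computes X x₂ 1) (he : Computes X e 1)
    (hf : Computes X f 1) :
    Computes X (fun γ => (inst γ).addr (i γ) (x₁ γ) (x₂ γ) (e γ) (f γ)) 1 := by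
  have step {u v : X.Γ → ℕ} (hu : Computes X u 1) (hv : Computes X v 1) :
      Computes X (fun γ => (inst γ).radix * u γ + v γ) 1 :=
    (Computes.mul (a := 0) (d := 1) h.computes_radix hu fun γ _ _ => h.radix_le γ).add hv
  exact step (step (step (step (hi.add (.const 1)) h₁) h₂) he) hf

theorem Ctx.Over.computes_entry (h : X.Over inst) {q i x₁ x₂ e f : X.Γ → ℕ}
    (hM : ∀ γ ρ M, X.regs γ ρ → X.mem γ M → (inst γ).Filled (q γ) M ∧ x₁ γ < (inst γ).radix ∧
      x₂ γ < (inst γ).radix ∧ e γ < (inst γ).radix ∧ f γ < (inst γ).radix ∧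
      (inst γ).addr (i γ) (x₁ γ) (x₂ γ) (e γ) (f γ) < q γ)
    (hi : Computes X i 1) (h₁ : Computes X x₁ 1) (h₂ : Computes X x₂ 1) (he : Computes X e 1)
    (hf : Computes X f 1) :
    Computes X (fun γ => (inst γ).entry (i γ) (x₁ γ) (x₂ γ) (e γ) (f γ)) 1 :=
  Computes.load (h.computes_addr hi h₁ h₂ he hf) fun γ ρ M hρ hm => by
    obtain ⟨k, k₁, k₂, k₃, k₄, k₅⟩ := hM γ ρ M hρ hm
    exact k.2 _ _ _ _ _ k₁ k₂ k₃ k₄ k₅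

/-- The value of an entry of the table from the earlier entries. -/
theorem Ctx.Over.computes_entry_rec (h : X.Over inst) {i x₁ x₂ e f : X.Γ → ℕ}
    (hM : ∀ γ M, X.mem γ M → (inst γ).Filled
      ((inst γ).addr (i γ) (x₁ γ) (x₂ γ) (e γ) (f γ)) M)
    (hlt : ∀ γ ρ, X.regs γ ρ → x₁ γ < (inst γ).radix ∧ x₂ γ < (inst γ).radix ∧
      e γ < (inst γ).radix ∧ f γ < (inst γ).radix)
    (hi : HasReg X i) (h₁ : HasReg X x₁) (h₂ : HasReg X x₂) (he : HasReg X e) (hf : HasReg X f) :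
    Computes X (fun γ => (inst γ).entry (i γ) (x₁ γ) (x₂ γ) (e γ) (f γ)) 4 := by
  have hH : ∀ γ M, X.mem γ M → (inst γ).Holds M := fun γ M hm => (hM γ M hm).1
  refine (Computes.iteLE (e := i) (f := fun _ => 0)
    (g := fun γ => if f γ ≤ (inst γ).last then if (inst γ).last ≤ f γ then 1 else 0 else 0)
    (h := fun γ => pick ((inst γ).last + 1) fun c => ((inst γ).Slot c ∧
      (inst γ).Ok ((inst γ).cum (x₂ γ) - (inst γ).cum (x₁ γ)) (e γ) (f γ) c) ∧
      1 ≤ (inst γ).entry (i γ - 1) (x₁ γ) (x₂ γ) (f γ) c)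
    hi.computes (.const 0) ?_ ?_).congr fun γ _ _ _ _ => ?_
  · exact (Computes.iteLE hf.computes h.computes_last
      (Computes.iteLE h.computes_last hf.computes (.const 1) (.const 0)).restrict
        (.const 0)).restrict
  · have o := h.restrict (p := fun γ => ¬ i γ ≤ 0)
    have hx := (h.computes_cum hH h₂.computes).sub (h.computes_cum hH h₁.computes)
    refine Computes.pick (X := X.restrict fun γ => ¬ i γ ≤ 0) (a := 3) (d := 1) (C := 6)
      (p := fun g => ((inst g.1).Slot g.2 ∧
        (inst g.1).Ok ((inst g.1).cum (x₂ g.1) - (inst g.1).cum (x₁ g.1)) (e g.1) (f g.1) g.2) ∧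
        1 ≤ (inst g.1).entry (i g.1 - 1) (x₁ g.1) (x₂ g.1) (f g.1) g.2)
      (o.computes_last.add (.const 1)) (fun γ _ _ => ?_) fun r hr => ?_
    · have := (inst γ).len_le_size
      have := (inst γ).one_le_size
      rw [o.size, pow_one]
      unfold Instance.last
      omega
    · refine ((o.pop.decides_slot HasReg.top.computes).and
        (o.pop.decides_ok (fun γ M hm => hH γ.1 M hm) hx.restrict.pop he.restrict.pop.computes
          hf.restrict.pop.computes HasReg.top.computes).restrict).and
        (Decides.le (.const 1) ((o.pop.computes_entry
          (q := fun g => (inst g.1).addr (i g.1) (x₁ g.1) (x₂ g.1) (e g.1) (f g.1))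
          (fun g ρ M hg hm => ?_) (hi.restrict.pop.computes.sub (.const 1))
          h₁.restrict.pop.computes h₂.restrict.pop.computes hf.restrict.pop.computes
          HasReg.top.computes).mono (by norm_num))).restrict
      -- Every address of layer `i - 1` precedes all of layer `i`, so the entry to be read is
      -- already present; here `i ≠ 0` is essential.
      obtain ⟨⟨hρ, hpos⟩, -, hc⟩ := hg
      obtain ⟨k₁, k₂, k₃, k₄⟩ := hlt _ _ hρ
      have hc' : g.2 < (inst g.1).radix := by
        unfold Instance.last at hc; unfold Instance.radix; omega
      exact ⟨hM _ _ hm, k₁, k₂, k₄, hc', Instance.addr_lt (by omega) k₁ k₂ k₄ hc'⟩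
  · unfold Instance.entry
    rcases hi0 : i γ with _ | j
    · simp only [le_refl, if_true, Instance.val]
      split_ifs <;> first | rfl | omega
    · simp [Instance.val]

/-- The innermost of five nested loops that fill the table in the order of the addresses. Each of
them costs one more factor of the size. -/
theorem Ctx.Over.fill_row (h : X.Over inst) {i x₁ x₂ e : X.Γ → ℕ}
    (hM : ∀ γ M, X.mem γ M → (inst γ).Filled ((inst γ).addr (i γ) (x₁ γ) (x₂ γ) (e γ) 0) M)
    (hlt : ∀ γ ρ, X.regs γ ρ → x₁ γ < (inst γ).radix ∧ x₂ γ < (inst γ).radix ∧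
      e γ < (inst γ).radix)
    (hi : HasReg X i) (h₁ : HasReg X x₁) (h₂ : HasReg X x₂) (he : HasReg X e) :
    Executes X (fun γ => (inst γ).Filled ((inst γ).addr (i γ) (x₁ γ) (x₂ γ) (e γ + 1) 0)) 5 := by
  refine (Executes.for (a := 4) (d := 1) (C := 17) (B := fun γ => (inst γ).radix)
    (J := fun γ j => (inst γ).Filled ((inst γ).addr (i γ) (x₁ γ) (x₂ γ) (e γ) j))
    h.computes_radix (fun γ _ _ => h.radix_le γ) (fun γ _ M _ hm => hM γ M hm)
    fun r hr => ?_).imp fun g ρ M _ hm => ?_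
  swap
  -- The carry: last digit `radix` is the same address as the next digit increased by one and last
  -- digit 0.
  · convert hm using 1; simp only [Instance.addr]; ring
  have o := (h.pop (r := r) (hr := hr) (D := fun γ i => i < (inst γ).radix)).setMem
    (J := fun g => (inst g.1).Filled ((inst g.1).addr (i g.1) (x₁ g.1) (x₂ g.1) (e g.1) g.2))
  have reg {v : X.Γ × ℕ → ℕ} (hv : HasReg (X.push r hr fun γ i => i < (inst γ).radix) v) :
      HasReg ((X.push r hr fun γ i => i < (inst γ).radix).setMem fun g => (inst g.1).Filled
        ((inst g.1).addr (i g.1) (x₁ g.1) (x₂ g.1) (e g.1) g.2)) v := hv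
  refine Executes.store
    (e := fun g : X.Γ × ℕ => (inst g.1).addr (i g.1) (x₁ g.1) (x₂ g.1) (e g.1) g.2)
    (v := fun g : X.Γ × ℕ => (inst g.1).entry (i g.1) (x₁ g.1) (x₂ g.1) (e g.1) g.2)
    ((o.computes_addr (reg hi.pop).computes (reg h₁.pop).computes (reg h₂.pop).computes
      (reg he.pop).computes (reg .top).computes).mono (by norm_num))
    (o.computes_entry_rec (fun g M hm => hm) (fun g ρ hg => ?_) (reg hi.pop) (reg h₁.pop)
      (reg h₂.pop) (reg he.pop) (reg .top)) fun g ρ M hg hm => ?_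
  · obtain ⟨k₁, k₂, k₃⟩ := hlt _ _ hg.1
    exact ⟨k₁, k₂, k₃, hg.2.2⟩
  · obtain ⟨k₁, k₂, k₃⟩ := hlt _ _ hg.1
    exact Instance.Filled.update hm k₁ k₂ k₃ hg.2.2

theorem Ctx.Over.fill_rows (h : X.Over inst) {i x₁ x₂ : X.Γ → ℕ}
    (hM : ∀ γ M, X.mem γ M → (inst γ).Filled ((inst γ).addr (i γ) (x₁ γ) (x₂ γ) 0 0) M)
    (hlt : ∀ γ ρ, X.regs γ ρ → x₁ γ < (inst γ).radix ∧ x₂ γ < (inst γ).radix)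
    (hi : HasReg X i) (h₁ : HasReg X x₁) (h₂ : HasReg X x₂) :
    Executes X (fun γ => (inst γ).Filled ((inst γ).addr (i γ) (x₁ γ) (x₂ γ + 1) 0 0)) 6 := by
  refine (Executes.for (a := 5) (d := 1) (C := 17) (B := fun γ => (inst γ).radix)
    (J := fun γ j => (inst γ).Filled ((inst γ).addr (i γ) (x₁ γ) (x₂ γ) j 0))
    h.computes_radix (fun γ _ _ => h.radix_le γ) (fun γ _ M _ hm => hM γ M hm)
    fun r hr => ?_).imp fun g ρ M _ hm => ?_
  swap
  · convert hm using 1; simp only [Instance.addr]; ring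
  have o := (h.pop (r := r) (hr := hr) (D := fun γ i => i < (inst γ).radix)).setMem
    (J := fun g => (inst g.1).Filled ((inst g.1).addr (i g.1) (x₁ g.1) (x₂ g.1) g.2 0))
  have ht : HasReg (X.push r hr fun γ i => i < (inst γ).radix) fun g => g.2 := .top
  exact o.fill_row (i := fun g => i g.1) (x₁ := fun g => x₁ g.1) (x₂ := fun g => x₂ g.1) (e := fun g => g.2)
    (fun g M hm => hm) (fun g ρ hg => ⟨(hlt _ _ hg.1).1, (hlt _ _ hg.1).2, hg.2.2⟩)
    hi.pop.setMem h₁.pop.setMem h₂.pop.setMem ht.setMem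

theorem Ctx.Over.fill_block (h : X.Over inst) {i x₁ : X.Γ → ℕ}
    (hM : ∀ γ M, X.mem γ M → (inst γ).Filled ((inst γ).addr (i γ) (x₁ γ) 0 0 0) M)
    (hlt : ∀ γ ρ, X.regs γ ρ → x₁ γ < (inst γ).radix)
    (hi : HasReg X i) (h₁ : HasReg X x₁) :
    Executes X (fun γ => (inst γ).Filled ((inst γ).addr (i γ) (x₁ γ + 1) 0 0 0)) 7 := by
  refine (Executes.for (a := 6) (d := 1) (C := 17) (B := fun γ => (inst γ).radix)
    (J := fun γ j => (inst γ).Filled ((inst γ).addr (i γ) (x₁ γ) j 0 0))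
    h.computes_radix (fun γ _ _ => h.radix_le γ) (fun γ _ M _ hm => hM γ M hm)
    fun r hr => ?_).imp fun g ρ M _ hm => ?_
  swap
  · convert hm using 1; simp only [Instance.addr]; ring
  have o := (h.pop (r := r) (hr := hr) (D := fun γ i => i < (inst γ).radix)).setMem
    (J := fun g => (inst g.1).Filled ((inst g.1).addr (i g.1) (x₁ g.1) g.2 0 0))
  have ht : HasReg (X.push r hr fun γ i => i < (inst γ).radix) fun g => g.2 := .top
  exact o.fill_rows (i := fun g => i g.1) (x₁ := fun g => x₁ g.1) (x₂ := fun g => g.2)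
    (fun g M hm => hm) (fun g ρ hg => ⟨hlt _ _ hg.1, hg.2.2⟩) hi.pop.setMem h₁.pop.setMem ht.setMem

theorem Ctx.Over.fill_layer (h : X.Over inst) {i : X.Γ → ℕ}
    (hM : ∀ γ M, X.mem γ M → (inst γ).Filled ((inst γ).addr (i γ) 0 0 0 0) M)
    (hi : HasReg X i) :
    Executes X (fun γ => (inst γ).Filled ((inst γ).addr (i γ + 1) 0 0 0 0)) 8 := by
  refine (Executes.for (a := 7) (d := 1) (C := 17) (B := fun γ => (inst γ).radix)
    (J := fun γ j => (inst γ).Filled ((inst γ).addr (i γ) j 0 0 0))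
    h.computes_radix (fun γ _ _ => h.radix_le γ) (fun γ _ M _ hm => hM γ M hm)
    fun r hr => ?_).imp fun g ρ M _ hm => ?_
  swap
  · convert hm using 1; simp only [Instance.addr]; ring
  have o := (h.pop (r := r) (hr := hr) (D := fun γ i => i < (inst γ).radix)).setMem
    (J := fun g => (inst g.1).Filled ((inst g.1).addr (i g.1) g.2 0 0 0))
  have ht : HasReg (X.push r hr fun γ i => i < (inst γ).radix) fun g => g.2 := .top
  exact o.fill_block (i := fun g => i g.1) (x₁ := fun g => g.2)
    (fun g M hm => hm) (fun g ρ hg => hg.2.2) hi.pop.setMem ht.setMem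

theorem Ctx.Over.fill (h : X.Over inst)
    (hM : ∀ γ M, X.mem γ M → (inst γ).Filled ((inst γ).addr 0 0 0 0 0) M) :
    Executes X (fun γ => (inst γ).Filled ((inst γ).addr ((inst γ).m + 1) 0 0 0 0)) 9 := by
  refine Executes.for (a := 8) (d := 1) (C := 2) (B := fun γ => (inst γ).m + 1)
    (J := fun γ i => (inst γ).Filled ((inst γ).addr i 0 0 0 0))
    (h.m.computes.add (.const 1)) (fun γ _ _ => ?_) (fun γ _ M _ hm => hM γ M hm) fun r hr => ?_
  · have := (inst γ).len_le_size
    have := (inst γ).m_lt_len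
    rw [h.size, pow_one]
    omega
  have o := (h.pop (r := r) (hr := hr) (D := fun γ i => i < (inst γ).m + 1)).setMem
    (J := fun g => (inst g.1).Filled ((inst g.1).addr g.2 0 0 0 0))
  have ht : HasReg (X.push r hr fun γ i => i < (inst γ).m + 1) fun g => g.2 := .top
  exact o.fill_layer (i := fun g => g.2) (fun g M hm => hm) ht.setMem

end computes

end Hotelling

/-! ### Reading off the solution and assembling the program -/

namespace Hotelling

variable {X : Ctx} {a d : ℕ}

namespace Instance

/-- The first address behind the table. -/
def tableEnd (I : Instance) : ℕ := I.addr (I.m + 1) 0 0 0 0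

theorem addr_lt_tableEnd {I : Instance} {i x₁ x₂ a b : ℕ} (h : i ≤ I.m) (h₁ : x₁ < I.radix)
    (h₂ : x₂ < I.radix) (ha : a < I.radix) (hb : b < I.radix) :
    I.addr i x₁ x₂ a b < I.tableEnd :=
  addr_lt (by omega) h₁ h₂ ha hb

theorem radix_le_tableEnd (I : Instance) : I.radix ≤ I.tableEnd := I.radix_le_addr _ _ _ _ _

theorem addr_succ_m (I : Instance) (j : ℕ) : I.addr (I.m + 1) 0 0 0 j = I.tableEnd + j := rfl

theorem Filled.update_of_le {I : Instance} {q x v : ℕ} {M : ℕ → ℕ} (h : I.Filled q M)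
    (hK : I.radix ≤ q) (hx : q ≤ x) : I.Filled q (Function.update M x v) :=
  ⟨h.1.update (hK.trans hx), fun i x₁ x₂ a b h₁ h₂ ha hb hlt => by
    rw [Function.update_of_ne (by omega)]; exact h.2 i x₁ x₂ a b h₁ h₂ ha hb hlt⟩

theorem last_lt_radix (I : Instance) : I.last < I.radix := by unfold last radix; omega

theorem val_le (I : Instance) (T i a b : ℕ) : I.val T i a b ≤ I.last + 1 := by
  cases i with
  | zero => rw [val]; split_ifs <;> omega
  | succ i => rw [val]; exact pick_le _ _

theorem path_lt_radix {I : Instance} {T b : ℕ} (hb : b < I.radix) :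
    ∀ j, I.path T b j < I.radix
  | 0 => by rw [path]; omega
  | 1 => by rwa [path]
  | j + 2 => by
    have h₁ := I.val_le T (I.m - j) (I.path T b j) (I.path T b (j + 1))
    have h₂ := I.last_lt_radix
    rw [path]
    omega

/-- The first component of a solution, if there is one. -/
noncomputable def sol₁ (I : Instance) : ℕ :=
  pick I.radix (fun x₁ => ∃ x₂ < I.radix, ∃ b < I.radix, I.Solution x₁ x₂ b) - 1

/-- The second component of a solution, if there is one. -/
noncomputable def sol₂ (I : Instance) : ℕ :=
  pick I.radix (fun x₂ => ∃ b < I.radix, I.Solution I.sol₁ x₂ b) - 1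

/-- The third component of a solution, if there is one. -/
noncomputable def sol₃ (I : Instance) : ℕ :=
  pick I.radix (fun b => I.Solution I.sol₁ I.sol₂ b) - 1

/-- Also true when nothing is found, so the later reads and writes stay in range even without a
solution. -/
theorem pick_sub_one_lt_radix (I : Instance) (p : ℕ → Prop) : pick I.radix p - 1 < I.radix := by
  have := pick_le I.radix p
  have : 0 < I.radix := by unfold radix; omega
  omega

theorem solution_sol {I : Instance}
    (h : ∃ x₁ < I.radix, ∃ x₂ < I.radix, ∃ b < I.radix, I.Solution x₁ x₂ b) :
    I.Solution I.sol₁ I.sol₂ I.sol₃ := by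
  have h₁ := (pick_sub_one_spec (one_le_pick_iff.2 h)).2
  have h₂ := (pick_sub_one_spec (one_le_pick_iff.2 h₁)).2
  exact (pick_sub_one_spec (one_le_pick_iff.2 h₂)).2

/-- The path of the solution. -/
noncomputable def solPath (I : Instance) : ℕ → ℕ := I.path (I.cum I.sol₂ - I.cum I.sol₁) I.sol₃

end Instance

/-! ### Search for a solution and output of its path -/

section computes

variable {inst : X.Γ → Instance}

theorem Ctx.Over.decides_solution (h : X.Over inst)
    (hM : ∀ γ M, X.mem γ M → (inst γ).Filled (inst γ).tableEnd M) {x₁ x₂ b : X.Γ → ℕ}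
    (h₁ : HasReg X x₁) (h₂ : HasReg X x₂) (hb : HasReg X b)
    (hlt : ∀ γ ρ, X.regs γ ρ → x₁ γ < (inst γ).radix ∧ x₂ γ < (inst γ).radix ∧
      b γ < (inst γ).radix) :
    Decides X (fun γ => (inst γ).Solution (x₁ γ) (x₂ γ) (b γ)) 1 :=
  (h.decides_slot hb.computes).and (Decides.le (.const 1) (h.computes_entry
    (i := fun γ => (inst γ).m) (e := fun _ => 0) (fun γ ρ M hρ hm => by
      obtain ⟨k₁, k₂, k₃⟩ := hlt γ ρ hρ
      have h0 : 0 < (inst γ).radix := by omega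
      exact ⟨hM γ M hm, k₁, k₂, h0, k₃, Instance.addr_lt_tableEnd le_rfl k₁ k₂ h0 k₃⟩)
    h.m.computes h₁.computes h₂.computes (.const 0) hb.computes)).restrict

theorem Ctx.Over.decides_exists₁ (h : X.Over inst)
    (hM : ∀ γ M, X.mem γ M → (inst γ).Filled (inst γ).tableEnd M) {x₁ x₂ : X.Γ → ℕ}
    (h₁ : HasReg X x₁) (h₂ : HasReg X x₂)
    (hlt : ∀ γ ρ, X.regs γ ρ → x₁ γ < (inst γ).radix ∧ x₂ γ < (inst γ).radix) :
    Decides X (fun γ => ∃ b < (inst γ).radix, (inst γ).Solution (x₁ γ) (x₂ γ) b) 2 :=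
  Decides.exists_lt (a := 1) (d := 1) (C := 17)
    (p := fun g => (inst g.1).Solution (x₁ g.1) (x₂ g.1) g.2) h.computes_radix
    (fun γ _ _ => h.radix_le γ) fun _ _ => h.pop.decides_solution (fun g M hm => hM g.1 M hm)
      h₁.pop h₂.pop .top fun _ _ hg => ⟨(hlt _ _ hg.1).1, (hlt _ _ hg.1).2, hg.2.2⟩

theorem Ctx.Over.decides_exists₂ (h : X.Over inst)
    (hM : ∀ γ M, X.mem γ M → (inst γ).Filled (inst γ).tableEnd M) {x₁ : X.Γ → ℕ}
    (h₁ : HasReg X x₁) (hlt : ∀ γ ρ, X.regs γ ρ → x₁ γ < (inst γ).radix) :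
    Decides X (fun γ => ∃ x₂ < (inst γ).radix, ∃ b < (inst γ).radix,
      (inst γ).Solution (x₁ γ) x₂ b) 3 :=
  Decides.exists_lt (a := 2) (d := 1) (C := 17)
    (p := fun g => ∃ b < (inst g.1).radix, (inst g.1).Solution (x₁ g.1) g.2 b) h.computes_radix
    (fun γ _ _ => h.radix_le γ) fun _ _ => h.pop.decides_exists₁ (fun g M hm => hM g.1 M hm)
      h₁.pop .top fun _ _ hg => ⟨hlt _ _ hg.1, hg.2.2⟩

theorem Ctx.Over.decides_exists₃ (h : X.Over inst)
    (hM : ∀ γ M, X.mem γ M → (inst γ).Filled (inst γ).tableEnd M) :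
    Decides X (fun γ => ∃ x₁ < (inst γ).radix, ∃ x₂ < (inst γ).radix, ∃ b < (inst γ).radix,
      (inst γ).Solution x₁ x₂ b) 4 :=
  Decides.exists_lt (a := 3) (d := 1) (C := 17)
    (p := fun g => ∃ x₂ < (inst g.1).radix, ∃ b < (inst g.1).radix,
      (inst g.1).Solution g.2 x₂ b) h.computes_radix
    (fun γ _ _ => h.radix_le γ) fun _ _ => h.pop.decides_exists₂ (fun g M hm => hM g.1 M hm)
      .top fun _ _ hg => hg.2.2

theorem Ctx.Over.computes_sol₁ (h : X.Over inst)
    (hM : ∀ γ M, X.mem γ M → (inst γ).Filled (inst γ).tableEnd M) :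
    Computes X (fun γ => (inst γ).sol₁) 4 :=
  (Computes.pick (a := 3) (d := 1) (C := 17)
    (p := fun g => ∃ x₂ < (inst g.1).radix, ∃ b < (inst g.1).radix,
      (inst g.1).Solution g.2 x₂ b) h.computes_radix
    (fun γ _ _ => h.radix_le γ) fun _ _ => h.pop.decides_exists₂ (fun g M hm => hM g.1 M hm)
      .top fun _ _ hg => hg.2.2).sub (.const 1)

theorem Ctx.Over.computes_sol₂ (h : X.Over inst)
    (hM : ∀ γ M, X.mem γ M → (inst γ).Filled (inst γ).tableEnd M)
    (h₁ : HasReg X fun γ => (inst γ).sol₁) : Computes X (fun γ => (inst γ).sol₂) 3 :=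
  (Computes.pick (a := 2) (d := 1) (C := 17)
    (p := fun g => ∃ b < (inst g.1).radix, (inst g.1).Solution (inst g.1).sol₁ g.2 b)
    h.computes_radix
    (fun γ _ _ => h.radix_le γ) fun _ _ => h.pop.decides_exists₁ (fun g M hm => hM g.1 M hm)
      h₁.pop .top fun g _ hg => ⟨(inst g.1).pick_sub_one_lt_radix _, hg.2.2⟩).sub (.const 1)

theorem Ctx.Over.computes_sol₃ (h : X.Over inst)
    (hM : ∀ γ M, X.mem γ M → (inst γ).Filled (inst γ).tableEnd M)
    (h₁ : HasReg X fun γ => (inst γ).sol₁) (h₂ : HasReg X fun γ => (inst γ).sol₂) :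
    Computes X (fun γ => (inst γ).sol₃) 2 :=
  (Computes.pick (a := 1) (d := 1) (C := 17)
    (p := fun g => (inst g.1).Solution (inst g.1).sol₁ (inst g.1).sol₂ g.2)
    h.computes_radix
    (fun γ _ _ => h.radix_le γ) fun _ _ => h.pop.decides_solution (fun g M hm => hM g.1 M hm)
      h₁.pop h₂.pop .top fun g _ hg => ⟨(inst g.1).pick_sub_one_lt_radix _,
        (inst g.1).pick_sub_one_lt_radix _, hg.2.2⟩).sub (.const 1)

/-- The recursion for the path needs its two preceding values and the table. The path is therefore
stored behind the table, and both remain readable. -/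
theorem Ctx.Over.write_path (h : X.Over inst)
    (hM : ∀ γ M, X.mem γ M → (inst γ).Filled (inst γ).tableEnd M)
    (h₁ : HasReg X fun γ => (inst γ).sol₁) (h₂ : HasReg X fun γ => (inst γ).sol₂)
    (h₃ : HasReg X fun γ => (inst γ).sol₃) :
    Executes X (fun γ M => ∀ j < (inst γ).m + 2,
      M ((inst γ).tableEnd + j) = (inst γ).solPath j) 2 := by
  refine (Executes.for (a := 1) (d := 1) (C := 3) (B := fun γ => (inst γ).m + 2)
    (J := fun γ i M => (inst γ).Filled (inst γ).tableEnd M ∧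
      ∀ j < i, M ((inst γ).tableEnd + j) = (inst γ).solPath j)
    (h.m.computes.add (.const 2)) (fun γ _ _ => ?_)
    (fun γ _ M _ hm => ⟨hM γ M hm, fun j hj => absurd hj j.not_lt_zero⟩) fun r hr => ?_).imp
    fun g ρ M _ hm => hm.2
  · have := (inst γ).len_le_size
    have := (inst γ).m_lt_len
    rw [h.size, pow_one]
    omega
  have o := (h.pop (r := r) (hr := hr) (D := fun γ i => i < (inst γ).m + 2)).setMem
    (J := fun g M => (inst g.1).Filled (inst g.1).tableEnd M ∧
      ∀ j < g.2, M ((inst g.1).tableEnd + j) = (inst g.1).solPath j)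
  set Y := ((X.push r hr fun γ i => i < (inst γ).m + 2).setMem fun g M =>
    (inst g.1).Filled (inst g.1).tableEnd M ∧
      ∀ j < g.2, M ((inst g.1).tableEnd + j) = (inst g.1).solPath j)
  have reg {v : X.Γ × ℕ → ℕ} (hv : HasReg (X.push r hr fun γ i => i < (inst γ).m + 2) v) :
      HasReg Y v := hv
  have hj {p : Y.Γ → Prop} {e : Y.Γ → ℕ} {k : ℕ} (hk : 1 ≤ k) (hp : ∀ g : X.Γ × ℕ, p g → 1 ≤ g.2)
      (he : ∀ g : X.Γ × ℕ, e g = g.2 - k) :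
      Computes (Y.restrict p) (fun g : X.Γ × ℕ => (inst g.1).solPath (e g)) 1 := by
    refine Computes.load ((o.restrict (p := p)).computes_addr
      (i := fun g : X.Γ × ℕ => (inst g.1).m + 1) (x₁ := fun _ => 0) (x₂ := fun _ => 0)
      (e := fun _ => 0) (f := fun g : X.Γ × ℕ => g.2 - k) (o.restrict.m.computes.add (.const 1))
      (.const 0) (.const 0) (.const 0) ((reg .top).restrict.computes.sub (.const k)))
      fun g ρ M hg hm => ?_
    have := hp g hg.2
    rw [Instance.addr_succ_m, he]
    exact hm.2 _ (by omega)
  refine Executes.store (e := fun g : X.Γ × ℕ => (inst g.1).addr ((inst g.1).m + 1) 0 0 0 g.2)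
    (v := fun g : X.Γ × ℕ => (inst g.1).solPath g.2)
    (o.computes_addr (o.m.computes.add (.const 1)) (.const 0) (.const 0) (.const 0)
      (reg .top).computes) ?_ fun g ρ M hg hm => ?_
  -- The tests against 1 and 0 separate the three clauses of `path`.
  · refine (Computes.iteLE (e := fun g : X.Γ × ℕ => g.2) (f := fun _ => 1)
      (g := fun g : X.Γ × ℕ => if g.2 ≤ 0 then 0 else (inst g.1).sol₃)
      (h := fun g : X.Γ × ℕ => (inst g.1).entry ((inst g.1).m - (g.2 - 2)) (inst g.1).sol₁
        (inst g.1).sol₂ ((inst g.1).solPath (g.2 - 2)) ((inst g.1).solPath (g.2 - 1)) - 1)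
      (reg .top).computes (.const 1) ?_ ?_).congr fun g _ _ _ _ => ?_
    · exact (Computes.iteLE (reg .top).computes (.const 0) (.const 0)
        (reg h₃.pop).restrict.computes).restrict
    · refine ((o.restrict (p := fun g : X.Γ × ℕ => ¬ g.2 ≤ 1)).computes_entry
        (q := fun g : X.Γ × ℕ => (inst g.1).tableEnd)
        (i := fun g : X.Γ × ℕ => (inst g.1).m - (g.2 - 2))
        (fun g ρ M hg hm => ?_)
        (o.m.restrict.computes.sub ((reg .top).restrict.computes.sub (.const 2)))
        (reg h₁.pop).restrict.computes (reg h₂.pop).restrict.computes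
        (hj (e := fun g => g.2 - 2) (k := 2) (by norm_num) (fun g hg => by omega) fun _ => rfl)
        (hj (e := fun g => g.2 - 1) (k := 1) le_rfl (fun g hg => by omega)
          fun _ => rfl)).sub (.const 1)
      have l₁ : (inst g.1).sol₁ < (inst g.1).radix := (inst g.1).pick_sub_one_lt_radix _
      have l₂ : (inst g.1).sol₂ < (inst g.1).radix := (inst g.1).pick_sub_one_lt_radix _
      have l₃ : (inst g.1).sol₃ < (inst g.1).radix := (inst g.1).pick_sub_one_lt_radix _
      exact ⟨hm.1, l₁, l₂, Instance.path_lt_radix l₃ _, Instance.path_lt_radix l₃ _,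
        Instance.addr_lt_tableEnd (Nat.sub_le _ _) l₁ l₂ (Instance.path_lt_radix l₃ _)
          (Instance.path_lt_radix l₃ _)⟩
    · obtain ⟨γ, j⟩ := g
      rcases j with _ | _ | j
      · simp [Instance.solPath, Instance.path]
      · simp [Instance.solPath, Instance.path]
      · simp [Instance.solPath, Instance.path, Instance.entry]
  · refine ⟨hm.1.update_of_le (inst g.1).radix_le_tableEnd (Nat.le_add_right _ _),
      fun j hj => ?_⟩
    rw [Instance.addr_succ_m]
    rcases Nat.lt_succ_iff_lt_or_eq.1 hj with hj | rfl
    · rw [Function.update_of_ne (by omega)]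
      exact hm.2 j hj
    · rw [Function.update_self]

/-- The copy may overwrite the input, which is no longer needed; it does not reach the stored path
because `m < tableEnd`. -/
theorem Ctx.Over.write_output (h : X.Over inst)
    (hM : ∀ γ M, X.mem γ M → ∀ j < (inst γ).m + 2,
      M ((inst γ).tableEnd + j) = (inst γ).solPath j) :
    Executes X (fun γ M => ∀ j < (inst γ).m,
      M j = (inst γ).solPath (j + 1) - ((inst γ).len + 1)) 2 := by
  refine (Executes.for (a := 1) (d := 1) (C := 1) (B := fun γ => (inst γ).m)
    (J := fun γ i M => (∀ j < (inst γ).m + 2, M ((inst γ).tableEnd + j) = (inst γ).solPath j) ∧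
      ∀ j < i, M j = (inst γ).solPath (j + 1) - ((inst γ).len + 1))
    h.m.computes (fun γ _ _ => ?_)
    (fun γ _ M _ hm => ⟨hM γ M hm, fun j hj => absurd hj j.not_lt_zero⟩) fun r hr => ?_).imp
    fun g ρ M _ hm => hm.2
  · have := (inst γ).len_le_size
    have := (inst γ).m_lt_len
    rw [h.size, pow_one]
    omega
  have o := (h.pop (r := r) (hr := hr) (D := fun γ i => i < (inst γ).m)).setMem
    (J := fun g M => (∀ j < (inst g.1).m + 2,
        M ((inst g.1).tableEnd + j) = (inst g.1).solPath j) ∧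
      ∀ j < g.2, M j = (inst g.1).solPath (j + 1) - ((inst g.1).len + 1))
  set Y := ((X.push r hr fun γ i => i < (inst γ).m).setMem fun g M =>
    (∀ j < (inst g.1).m + 2, M ((inst g.1).tableEnd + j) = (inst g.1).solPath j) ∧
      ∀ j < g.2, M j = (inst g.1).solPath (j + 1) - ((inst g.1).len + 1))
  have ht₀ : HasReg (X.push r hr fun γ i => i < (inst γ).m) fun g => g.2 := .top
  have ht : HasReg Y fun g : X.Γ × ℕ => g.2 := ht₀
  refine Executes.store (e := fun g : X.Γ × ℕ => g.2)
    (v := fun g : X.Γ × ℕ => (inst g.1).solPath (g.2 + 1) - ((inst g.1).len + 1))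
    ht.computes ((Computes.load (o.computes_addr
      (i := fun g : X.Γ × ℕ => (inst g.1).m + 1) (x₁ := fun _ => 0) (x₂ := fun _ => 0)
      (e := fun _ => 0) (f := fun g : X.Γ × ℕ => g.2 + 1) (o.m.computes.add (.const 1))
      (.const 0) (.const 0) (.const 0) (ht.computes.add (.const 1))) fun g ρ M hg hm => ?_).sub
      (o.len.computes.add (.const 1))) fun g ρ M hg hm => ?_
  · have := hg.2.2
    rw [Instance.addr_succ_m]
    exact hm.1 _ (by omega)
  · have h₁ : g.2 < (inst g.1).m := hg.2.2
    have h₂ : (inst g.1).m < (inst g.1).tableEnd := by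
      have := (inst g.1).radix_le_tableEnd
      have := (inst g.1).m_lt_len
      unfold Instance.radix at *
      omega
    refine ⟨fun j hj => ?_, fun j hj => ?_⟩
    · rw [Function.update_of_ne (by omega)]
      exact hm.1 j hj
    · rcases Nat.lt_succ_iff_lt_or_eq.1 hj with hj | rfl
      · rw [Function.update_of_ne (by omega)]
        exact hm.2 j hj
      · rw [Function.update_self]

theorem Ctx.Over.write_solution (h : X.Over inst)
    (hM : ∀ γ M, X.mem γ M → (inst γ).Filled (inst γ).tableEnd M) :
    Executes X (fun γ M => ∀ j < (inst γ).m,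
      M j = (inst γ).solPath (j + 1) - ((inst γ).len + 1)) 4 := by
  refine .bind (h.computes_sol₁ hM) fun r₁ hr₁ => ?_
  have e₁ : HasReg (X.push r₁ hr₁ fun γ x => x = (inst γ).sol₁) fun g => (inst g.1).sol₁ :=
    ⟨r₁, Nat.lt_succ_self _, fun g ρ hg => hg.2.1.trans hg.2.2⟩
  have o₁ := h.pop (r := r₁) (hr := hr₁) (D := fun γ x => x = (inst γ).sol₁)
  refine .bind ((o₁.computes_sol₂ (fun g M hm => hM g.1 M hm) e₁).mono (by norm_num))
    fun r₂ hr₂ => ?_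
  set X₁ := X.push r₁ hr₁ fun γ x => x = (inst γ).sol₁
  have e₂ : HasReg (X₁.push r₂ hr₂ fun γ x => x = (inst γ.1).sol₂) fun g => (inst g.1.1).sol₂ :=
    ⟨r₂, Nat.lt_succ_self _, fun g ρ hg => hg.2.1.trans hg.2.2⟩
  have o₂ := o₁.pop (r := r₂) (hr := hr₂) (D := fun γ x => x = (inst γ.1).sol₂)
  refine .bind ((o₂.computes_sol₃ (fun g M hm => hM g.1.1 M hm) e₁.pop e₂).mono (by norm_num))
    fun r₃ hr₃ => ?_
  set X₂ := X₁.push r₂ hr₂ fun γ x => x = (inst γ.1).sol₂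
  have e₃ : HasReg (X₂.push r₃ hr₃ fun γ x => x = (inst γ.1.1).sol₃)
      fun g => (inst g.1.1.1).sol₃ :=
    ⟨r₃, Nat.lt_succ_self _, fun g ρ hg => hg.2.1.trans hg.2.2⟩
  have o₃ := o₂.pop (r := r₃) (hr := hr₃) (D := fun γ x => x = (inst γ.1.1).sol₃)
  exact Executes.mono ((o₃.write_path (fun g M hm => hM g.1.1.1 M hm) e₁.pop.pop e₂.pop e₃).seq
    ((o₃.setMem (J := fun g M => ∀ j < (inst g.1.1.1).m + 2,
      M ((inst g.1.1.1).tableEnd + j) = (inst g.1.1.1).solPath j)).write_output fun g M hm => hm)) (by norm_num)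

end computes

/-- The context knows the input registers of the instance `inst γ`. -/
structure Ctx.Knows (X : Ctx) (inst : X.Γ → Instance) : Prop where
  size : ∀ γ, X.size γ = (inst γ).size
  m : HasReg X fun γ => (inst γ).m
  R : HasReg X fun γ => (inst γ).R
  card : HasReg X fun γ => (inst γ).voters.card

/-! ### Preprocessing: the power of two and the grid length -/

section computes

variable {inst : X.Γ → Instance}

theorem Ctx.Knows.setMem (h : X.Knows inst) {J : X.Γ → (ℕ → ℕ) → Prop} :
    (X.setMem J).Knows inst :=
  ⟨h.size, h.m, h.R, h.card⟩

/-- Doubling `m` times, each time at constant cost. -/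
theorem Ctx.Knows.computes_pow (h : X.Knows inst) :
    Computes X (fun γ => 2 ^ (inst γ).m) 1 := by
  refine (Computes.fold (a := 0) (d := 1) (C := 1) (B := fun γ => (inst γ).m) (e₀ := fun _ => 1)
    (f := fun g => g.2 + g.2) h.m.computes (.const 1) (fun γ _ _ => ?_)
    fun r hr => Computes.top.add Computes.top).congr fun γ _ _ _ _ => ?_
  · have := (inst γ).len_le_size
    have := (inst γ).m_lt_len
    rw [h.size, pow_one]
    omega
  · induction (inst γ).m with
    | zero => rfl
    | succ q ih => simp only at ih ⊢; rw [ih, pow_succ]; ring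

/-- The context after computing `2 ^ m` and the length of the interval. -/
abbrev Ctx.prepare (X : Ctx) (inst : X.Γ → Instance) (r₁ : ℕ) (hr₁ : X.b ≤ r₁) (r₂ : ℕ)
    (hr₂ : r₁ + 1 ≤ r₂) : Ctx :=
  (X.push r₁ hr₁ fun γ x => x = 2 ^ (inst γ).m).push r₂ hr₂ fun g x => x = (inst g.1).len

theorem Ctx.Knows.over_prepare (h : X.Knows inst) {r₁ : ℕ} {hr₁ : X.b ≤ r₁} {r₂ : ℕ}
    {hr₂ : r₁ + 1 ≤ r₂} : (X.prepare inst r₁ hr₁ r₂ hr₂).Over (fun g => inst g.1.1) :=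
  ⟨fun g => h.size g.1.1, h.m.pop.pop, h.card.pop.pop,
    ⟨r₁, by simp only; omega, fun g ρ hg => hg.1.2.1.trans hg.1.2.2⟩,
    ⟨r₂, by simp only; omega, fun g ρ hg => hg.2.1.trans hg.2.2⟩⟩

theorem Ctx.Knows.computes_len (h : X.Knows inst) {r : ℕ} {hr : X.b ≤ r} :
    Computes (X.push r hr fun γ x => x = 2 ^ (inst γ).m) (fun g => (inst g.1).len) 1 :=
  Computes.mul (X := X.push r hr fun γ x => x = 2 ^ (inst γ).m) (a := 0) (d := 1) (C := 1)
    (e := fun g => (inst g.1).R)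
    (f := fun g => 2 ^ (inst g.1).m) h.R.pop.computes
    (HasReg.computes ⟨r, Nat.lt_succ_self _, fun g ρ hg => hg.2.1.trans hg.2.2⟩) fun g _ _ => by
      have := (inst g.1).len_le_size
      have := (inst g.1).R_le_len
      simp only [h.size, pow_one]
      omega

theorem Ctx.Knows.executes (h : X.Knows inst) {post : X.Γ → (ℕ → ℕ) → Prop} (ha : 1 ≤ a)
    (hpost : ∀ (r₁ : ℕ) (hr₁ : X.b ≤ r₁) (r₂ : ℕ) (hr₂ : r₁ + 1 ≤ r₂),
      Executes (X.prepare inst r₁ hr₁ r₂ hr₂) (fun g => post g.1.1) a) : Executes X post a :=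
  .bind (h.computes_pow.mono ha) fun r₁ hr₁ =>
    .bind (h.computes_len.mono ha) fun r₂ hr₂ => hpost r₁ hr₁ r₂ hr₂

theorem Ctx.Knows.computes (h : X.Knows inst) {e : X.Γ → ℕ} (ha : 1 ≤ a)
    (he : ∀ (r₁ : ℕ) (hr₁ : X.b ≤ r₁) (r₂ : ℕ) (hr₂ : r₁ + 1 ≤ r₂),
      Computes (X.prepare inst r₁ hr₁ r₂ hr₂) (fun g => e g.1.1) a) : Computes X e a :=
  .bind (f := fun g => e g.1) (h.computes_pow.mono ha) fun r₁ hr₁ =>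
    .bind (f := fun g : (X.Γ × ℕ) × ℕ => e g.1.1) (h.computes_len.mono ha)
      fun r₂ hr₂ => he r₁ hr₁ r₂ hr₂

end computes

/-- The context of the input. -/
abbrev inputCtx : Ctx where
  Γ := Instance
  b := 3
  size := Instance.size
  size_pos := Instance.one_le_size
  regs := fun I ρ => ρ 0 = I.m ∧ ρ 1 = I.R ∧ ρ 2 = I.voters.card
  mem := Instance.Holds
  regs_congr := fun I ρ ρ' h hρ => by
    rw [h 0 (by norm_num), h 1 (by norm_num), h 2 (by norm_num)]; exact hρ

theorem inputCtx_knows : inputCtx.Knows fun I => I :=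
  ⟨fun _ => rfl, ⟨0, by norm_num, fun _ _ h => h.1⟩, ⟨1, by norm_num, fun _ _ h => h.2.1⟩,
    ⟨2, by norm_num, fun _ _ h => h.2.2⟩⟩

/-- Filling the table dominates the running time; the search and the output cost only `O(size ^ 4)`.
-/
theorem exists_prog : ∃ (A : Prog) (c : ℕ), ∀ I : Instance, ∃ τ t, Runs A I.input τ t ∧
    I.CorrectAnswer τ ∧ t ≤ c * I.size ^ 9 := by
  classical
  have hfill : Executes inputCtx (fun I => I.Filled I.tableEnd) 9 :=
    inputCtx_knows.executes (by norm_num) fun r₁ hr₁ r₂ hr₂ =>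
      inputCtx_knows.over_prepare.fill fun g M hm => ⟨hm, fun i x₁ x₂ a b h₁ h₂ ha hb hlt => by
        -- The first address is minimal, so the table condition is vacuous at the start.
        have : g.1.1.addr 0 0 0 0 0 ≤ g.1.1.addr i x₁ x₂ a b := by
          unfold Instance.addr
          refine le_trans (Nat.mul_le_mul_left _ ?_) (Nat.le_add_right _ _)
          refine le_trans (Nat.mul_le_mul_left _ ?_) (Nat.le_add_right _ _)
          refine le_trans (Nat.mul_le_mul_left _ ?_) (Nat.le_add_right _ _)
          exact le_trans (Nat.mul_le_mul_left _ (by omega)) (Nat.le_add_right _ _)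
        omega⟩
  have hk : (inputCtx.setMem fun I => I.Filled I.tableEnd).Knows fun I => I :=
    inputCtx_knows.setMem
  have hflag : Decides (inputCtx.setMem fun I => I.Filled I.tableEnd)
      (fun I => ∃ x₁ < I.radix, ∃ x₂ < I.radix, ∃ b < I.radix, I.Solution x₁ x₂ b) 4 :=
    hk.computes (by norm_num) fun r₁ hr₁ r₂ hr₂ =>
      hk.over_prepare.decides_exists₃ fun g M hm => hm
  have hwrite : Executes (inputCtx.setMem fun I => I.Filled I.tableEnd)
      (fun I M => ∀ j < I.m, M j = I.solPath (j + 1) - (I.len + 1)) 4 :=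
    hk.executes (by norm_num) fun r₁ hr₁ r₂ hr₂ =>
      hk.over_prepare.write_solution fun g M hm => hm
  obtain ⟨P₁, c₁, h₁⟩ := hfill 3 le_rfl
  obtain ⟨P₂, c₂, h₂⟩ := hflag 3 le_rfl
  -- Level 4 protects the flag in register 3. The output is written in any case and is meaningful
  -- only if the flag is 1.
  obtain ⟨P₃, c₃, h₃⟩ := hwrite 4 (by norm_num)
  refine ⟨.seq P₁ (.seq P₂ (.seq P₃ (.assign 0 (.reg 3)))), c₁ + c₂ + c₃ + 2, fun I => ?_⟩
  obtain ⟨σ₁, t₁, r₁, l₁, f₁, m₁⟩ := h₁ I I.input ⟨rfl, rfl, rfl⟩ fun _ _ => rfl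
  have k₁ : inputCtx.regs I σ₁.reg := inputCtx.regs_congr I I.input.reg _ f₁ ⟨rfl, rfl, rfl⟩
  obtain ⟨σ₂, t₂, r₂, l₂, m₂, f₂, v₂⟩ := h₂ I σ₁ k₁ m₁
  have k₂ : inputCtx.regs I σ₂.reg := inputCtx.regs_congr I σ₁.reg _ f₂ k₁
  obtain ⟨σ₃, t₃, r₃, l₃, f₃, m₃⟩ := h₃ I σ₂ k₂ (by rw [m₂]; exact m₁)
  refine ⟨_, _, .seq r₁ (.seq r₂ (.seq r₃ (.assign _ _ _))), ?_, ?_⟩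
  · have hval : σ₃.reg 3 = if ∃ x₁ < I.radix, ∃ x₂ < I.radix, ∃ b < I.radix,
        I.Solution x₁ x₂ b then 1 else 0 := by
      rw [f₃ 3 (by norm_num), v₂]
      beta_reduce
      congr
    have hsol (h : ∃ x₁ < I.radix, ∃ x₂ < I.radix, ∃ b < I.radix, I.Solution x₁ x₂ b) :
        I.IsEquilibrium (fun i : Fin I.m => (σ₃.mem i : ℝ) / 2 ^ I.m) := by
      convert (Instance.solution_sol h).isEquilibrium using 4 with i
      exact m₃ i i.2
    refine ⟨fun h => ?_, fun h => ?_⟩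
    · have h' := Instance.exists_solution h
      exact ⟨by simp only [Function.update_self, Expr.eval]; rw [hval]; exact if_pos h', hsol h'⟩
    · simp only [Function.update_self, Expr.eval]
      rw [hval]
      exact if_neg fun h' => h ⟨_, hsol h'⟩
  · have e : I.size ^ 4 ≤ I.size ^ 9 := Nat.pow_le_pow_right I.one_le_size (by norm_num)
    have e' : 1 ≤ I.size ^ 9 := Nat.one_le_pow _ _ I.one_le_size
    simp only [Expr.cost] at *
    nlinarith [Nat.mul_le_mul_left c₂ e, Nat.mul_le_mul_left c₃ e]

/-- Rounding `R` up to a power of two at most doubles it. -/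
theorem Instance.size_le (I : Instance) : I.size ≤ 2 * (I.R * 2 ^ I.m) := by
  have h : 2 ^ Nat.clog 2 I.R ≤ 2 * I.R := by
    rcases Nat.lt_or_ge 1 I.R with h | h
    · have := (Nat.pow_pred_clog_lt_self (b := 2) (by norm_num) h).le
      have hpos := Nat.clog_pos (b := 2) (by norm_num) h
      rw [← Nat.succ_pred_eq_of_pos hpos, pow_succ]
      omega
    · have := I.one_le_R
      obtain h₁ : I.R = 1 := by omega
      simp [h₁]
  unfold size
  rw [pow_add]
  nlinarith [Nat.mul_le_mul_right (2 ^ I.m) h]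

theorem Instance.two_le_card (I : Instance) : 2 ≤ I.voters.card :=
  Finset.one_lt_card.2 ⟨0, I.zero_mem, I.R, I.R_mem, by have := I.one_le_R; omega⟩

end Hotelling

theorem mainTheorem4 :
    ∃ A : Hotelling.Prog,
      (∃ C : ℕ, ∀ I : Hotelling.Instance,
        ∃ (τ : Hotelling.Store) (t : ℕ), Hotelling.Runs A I.input τ t ∧
          I.CorrectAnswer τ ∧ t ≤ C * (I.m * I.size ^ 12)) ∧
      (∀ d : ℕ, ∃ e : ℕ, ∀ I : Hotelling.Instance,
        2 ^ I.m ≤ I.voters.card ^ d → I.R ≤ I.voters.card ^ d →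
          ∃ (τ : Hotelling.Store) (t : ℕ), Hotelling.Runs A I.input τ t ∧
            I.CorrectAnswer τ ∧ t ≤ I.voters.card ^ e) := by
  obtain ⟨A, c, hA⟩ := Hotelling.exists_prog
  -- There are at least two voter positions, so powers of `card` absorb constants: `c ≤ card ^ c`,
  -- and `size ≤ 2 * (R * 2 ^ m) ≤ card ^ (1 + (d + d))`, which is then raised to the ninth power.
  refine ⟨A, ⟨c, fun I => ?_⟩, fun d => ⟨c + (1 + (d + d)) * 9, fun I hm hR => ?_⟩⟩
  · obtain ⟨τ, t, h₁, h₂, h₃⟩ := hA I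
    refine ⟨τ, t, h₁, h₂, h₃.trans (Nat.mul_le_mul_left c ?_)⟩
    exact (Nat.pow_le_pow_right I.one_le_size (by norm_num)).trans
      (Nat.le_mul_of_pos_left _ I.one_le_m)
  · obtain ⟨τ, t, h₁, h₂, h₃⟩ := hA I
    refine ⟨τ, t, h₁, h₂, h₃.trans ?_⟩
    have hn := I.two_le_card
    have hc : c ≤ I.voters.card ^ c :=
      (Nat.lt_two_pow_self (n := c)).le.trans (Nat.pow_le_pow_left hn c)
    have hs : I.size ≤ I.voters.card ^ (1 + (d + d)) := by
      refine I.size_le.trans ?_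
      rw [pow_add, pow_one, pow_add]
      exact Nat.mul_le_mul hn (Nat.mul_le_mul hR hm)
    rw [pow_add, pow_mul]
    exact Nat.mul_le_mul hc (Nat.pow_le_pow_left hs 9)
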